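/- Let $a\in(-1,0)\cup(0,\infty)$ and $\gamma_a=a(1+a)$. Let $(x_a,z_a)$ be the solution on $\mathbb R$ of $$x''=(1+2\gamma_a)x-2x^3,\qquad z'=x^2-\gamma_a,\qquad x(0)=1+a,\quad x'(0)=0,\quad z(0)=0,$$ and for $a\neq-\frac12$ let $2\tau_a$ be the least positive period of $x_a$. Let $X_a(t,\theta)=(x_a(t)\cos\theta,\,x_a(t)\sin\theta,\,z_a(t))$ be the corresponding Delaunay surface (of mean curvature $1$), $N_a=\frac{\partial_tX_a\wedge\partial_\theta X_a}{|\partial_tX_a\wedge\partial_\theta X_a|}$ its unit normal, $\mathfrak M(X)$ the mean curvature of a parametric surface $X=X(t,\theta)$, computed with respect to the normal $\frac{X_t\wedge X_\theta}{|X_t\wedge X_\theta|}$, and $$\mathfrak L_a\varphi=\frac{\partial}{\partial s}\Big|_{s=0}\mathfrak M(X_a+s\varphi N_a)$$ the Jacobi operator. Fix $\alpha\in(0,1)$, write $\mathbb S^1=\mathbb R/2\pi\mathbb Z$ and $\mathbb N=\{0,1,2,\dots\}$, and for $T>0$ let $\mathcal X_T$ be the space of all $\varphi\in C^{2,\alpha}([-T,T]\times\mathbb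 S^1)$ with $\varphi(\pm T,\cdot)=0$ and $\varphi(-t,\cdot)=\varphi(t,\cdot)$ for all $t\in[-T,T]$. Let $$\mathcal T_a=\{T>0 : \text{there is } \varphi\in\mathcal X_T\setminus\{0\} \text{ with } \mathfrak L_a\varphi=0 \text{ in } [-T,T]\times\mathbb S^1\},$$ and for $j\in\mathbb N$ let $\mathcal T_{a,j}$ be the set of all $T>0$ for which there is $\varphi\in C^2(\mathbb R\times\mathbb S^1)\setminus\{0\}$ of the form $\varphi(t,\theta)=w(t)\cos(j\theta)$, with $w$ even, such that $\mathfrak L_a\varphi=0$ on $\mathbb R\times\mathbb S^1$ and $\varphi(T,\cdot)=0$. Then $\mathcal T_a=\bigcup_{j=0}^\infty\mathcal T_{a,j}$ for every $a\in(-1,0)\cup(0,\infty)$. Moreover: (i) If $a\ne-\frac12$, then $\mathcal T_{a,0}=\{T_{a,k}\}_{k=0}^\infty$ with $T_{a,k}\in\big(k\tau_a,(k+\frac12)\tau_a\big)$ for every $k\in\mathbb N$. If $a=-\frac12$, then $\mathcal T_{a,0}=\{(k+\frac12)\pi\}_{k=0}^\infty$. (ii) If $a<0$, then $\mathcal T_{a,j}=\varnothing$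 for every $j\ge1$, and $\mathcal T_a=\mathcal T_{a,0}$. (iii) If $a>0$, then $\mathcal T_{a,1}=\{(k+\frac12)\tau_a\}_{k=0}^\infty$ and $\mathcal T_{a,0}\cap\mathcal T_{a,1}=\varnothing$. (iv) If $a\in\big(0,\frac12(\sqrt3-1)\big]$, then $\mathcal T_{a,j}=\varnothing$ for every $j\ge2$, and $\mathcal T_a=\mathcal T_{a,0}\cup\mathcal T_{a,1}$. (v) For every $j\ge2$ there exists $a_j^*>0$ such that $\mathcal T_{a,j}\ne\varnothing$ for all $a\ge a_j^*$. -/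

import Mathlib

open Set Filter Topology
open scoped NNReal Matrix

/-- The admissible Delaunay parameters: `(-1, 0) ∪ (0, ∞)`. -/
def delaunayParams : Set ℝ := Ioo (-1) 0 ∪ Ioi 0

/-- `γ_a = a (1 + a)`. -/
def delaunayGamma (a : ℝ) : ℝ := a * (1 + a)

/-- The initial value problem on `ℝ` for the Delaunay roulette `(x_a, z_a)`. -/
structure IsDelaunayProfile (a : ℝ) (x z : ℝ → ℝ) : Prop where
  contDiff_x : ContDiff ℝ 2 x
  ode_x : ∀ t, deriv (deriv x) t = (1 + 2 * delaunayGamma a) * x t - 2 * x t ^ 3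
  x_zero : x 0 = 1 + a
  deriv_x_zero : deriv x 0 = 0
  ode_z : ∀ t, HasDerivAt z (x t ^ 2 - delaunayGamma a) t
  z_zero : z 0 = 0

theorem exists_isDelaunayProfile {a : ℝ} (ha : a ∈ delaunayParams) :
    ∃ x z : ℝ → ℝ, IsDelaunayProfile a x z := by
  have ha0 : a ≠ 0 := by
    rcases ha with h | h
    · exact h.2.ne
    · exact (mem_Ioi.1 h).ne'
  have ha1 : 0 < 1 + a := by
    rcases ha with h | h
    · linarith [h.1]
    · linarith [mem_Ioi.1 h]
  -- `r` is the radius in terms of the amplitude; the amplitude solves `φ' = r φ`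
  set g : ℝ → ℝ := fun u => (1 + a) ^ 2 * Real.cos u ^ 2 + a ^ 2 * Real.sin u ^ 2 with hg
  have hgpos : ∀ u, 0 < g u := by
    intro u
    have h1 := Real.sin_sq_add_cos_sq u
    have h2 : 0 < a ^ 2 := by positivity
    have h3 : 0 < (1 + a) ^ 2 := by positivity
    simp only [hg]
    rcases eq_or_ne (Real.sin u) 0 with h | h
    · have : Real.cos u ^ 2 = 1 := by rw [h] at h1; linarith
      rw [this, h]; simpa using h3
    · have : 0 < Real.sin u ^ 2 := by positivity
      have : 0 < a ^ 2 * Real.sin u ^ 2 := by positivity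
      have : 0 ≤ (1 + a) ^ 2 * Real.cos u ^ 2 := by positivity
      linarith
  set M : ℝ := (1 + a) ^ 2 + a ^ 2 with hM
  have hMpos : 0 < M := by positivity
  have hgle : ∀ u, g u ≤ M := by
    intro u
    have h1 : Real.cos u ^ 2 ≤ 1 := Real.cos_sq_le_one u
    have h2 : Real.sin u ^ 2 ≤ 1 := Real.sin_sq_le_one u
    simp only [hg, hM]
    nlinarith [sq_nonneg a, sq_nonneg (1 + a)]
  have hgder : ∀ u, HasDerivAt g (-2 * (1 + 2 * a) * (Real.sin u * Real.cos u)) u := by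
    intro u
    have h := (((Real.hasDerivAt_cos u).pow 2).const_mul ((1 + a) ^ 2)).add
      (((Real.hasDerivAt_sin u).pow 2).const_mul (a ^ 2))
    refine h.congr_deriv ?_
    norm_num
    ring
  have hgcont : Continuous g := by fun_prop
  set r : ℝ → ℝ := fun u => Real.sqrt (g u) with hr
  have hrpos : ∀ u, 0 < r u := fun u => Real.sqrt_pos.2 (hgpos u)
  have hrsq : ∀ u, r u ^ 2 = g u := fun u => Real.sq_sqrt (hgpos u).le
  have hrcont : Continuous r := Real.continuous_sqrt.comp hgcont
  have hrle : ∀ u, r u ≤ Real.sqrt M := fun u => Real.sqrt_le_sqrt (hgle u)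
  have hic : Continuous fun u => (r u)⁻¹ := hrcont.inv₀ fun u => (hrpos u).ne'
  set F : ℝ → ℝ := fun u => ∫ s in (0 : ℝ)..u, (r s)⁻¹ with hF
  have hFder : ∀ u, HasDerivAt F (r u)⁻¹ u := fun u =>
    intervalIntegral.integral_hasDerivAt_right (hic.intervalIntegrable _ _)
      (hic.stronglyMeasurableAtFilter _ _) hic.continuousAt
  have hFmono : StrictMono F := strictMono_of_deriv_pos fun u => by
    rw [(hFder u).deriv]; exact inv_pos.2 (hrpos u)
  have hFcont : Continuous F := continuous_iff_continuousAt.2 fun u => (hFder u).continuousAt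
  have hFsub : Monotone fun u => F u - (Real.sqrt M)⁻¹ * u := by
    have hd : ∀ u, HasDerivAt (fun u => F u - (Real.sqrt M)⁻¹ * u)
        ((r u)⁻¹ - (Real.sqrt M)⁻¹ * 1) u := fun u =>
      (hFder u).sub ((hasDerivAt_id u).const_mul _)
    refine monotone_of_deriv_nonneg (fun u => (hd u).differentiableAt) fun u => ?_
    rw [(hd u).deriv, mul_one, sub_nonneg]
    exact inv_anti₀ (hrpos u) (hrle u)
  have hF0 : F 0 = 0 := by simp [hF]
  have hcpos : 0 < (Real.sqrt M)⁻¹ := inv_pos.2 (Real.sqrt_pos.2 hMpos)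
  have htop : Tendsto F atTop atTop := by
    refine tendsto_atTop_mono' _ ?_ (tendsto_id.const_mul_atTop hcpos)
    filter_upwards [eventually_ge_atTop (0 : ℝ)] with u hu
    have := hFsub hu
    simp only [hF0, mul_zero, sub_zero] at this
    simp only [id]
    linarith
  have hbot : Tendsto F atBot atBot := by
    refine tendsto_atBot_mono' _ ?_ (tendsto_id.const_mul_atBot hcpos)
    filter_upwards [eventually_le_atBot (0 : ℝ)] with u hu
    have := hFsub hu
    simp only [hF0, mul_zero, sub_zero] at this
    simp only [id]
    linarith
  have hsurj : Function.Surjective F := hFcont.surjective htop hbot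
  set e : ℝ ≃o ℝ := hFmono.orderIsoOfSurjective F hsurj with he
  set φ : ℝ → ℝ := fun t => e.symm t with hφ
  have hFφ : ∀ t, F (φ t) = t := fun t => e.apply_symm_apply t
  have hφ0 : φ 0 = 0 := hFmono.injective (by rw [hFφ, hF0])
  have hφcont : Continuous φ := e.symm.continuous
  have hφder : ∀ t, HasDerivAt φ (r (φ t)) t := by
    intro t
    have := HasDerivAt.of_local_left_inverse (f := F) (g := φ) (a := t)
      hφcont.continuousAt (hFder (φ t)) (inv_pos.2 (hrpos _)).ne'
      (Eventually.of_forall hFφ)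
    simpa using this
  set x : ℝ → ℝ := fun t => r (φ t) with hx
  have hxder : ∀ t, HasDerivAt x (-(1 + 2 * a) * (Real.sin (φ t) * Real.cos (φ t))) t := by
    intro t
    have h := (((hgder (φ t)).comp t (hφder t)).sqrt (hgpos (φ t)).ne')
    refine h.congr_deriv ?_
    have h1 : Real.sqrt ((g ∘ φ) t) = r (φ t) := rfl
    rw [h1]
    have := (hrpos (φ t)).ne'
    field_simp
  have hdx : deriv x = fun t => -(1 + 2 * a) * (Real.sin (φ t) * Real.cos (φ t)) :=
    funext fun t => (hxder t).deriv
  have hdxder : ∀ t, HasDerivAt (deriv x)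
      (-(1 + 2 * a) * (Real.cos (φ t) ^ 2 - Real.sin (φ t) ^ 2) * x t) t := by
    intro t
    rw [hdx]
    have h := (((hφder t).sin).mul ((hφder t).cos)).const_mul (-(1 + 2 * a))
    refine h.congr_deriv ?_
    simp only [hx]
    ring
  have hxcont : Continuous x := hrcont.comp hφcont
  have hdd : deriv (deriv x) = fun t =>
      -(1 + 2 * a) * (Real.cos (φ t) ^ 2 - Real.sin (φ t) ^ 2) * x t :=
    funext fun t => (hdxder t).deriv
  have hgc : Continuous fun t => x t ^ 2 - delaunayGamma a := by fun_prop
  refine ⟨x, fun t => ∫ s in (0 : ℝ)..t, (x s ^ 2 - delaunayGamma a), ?_, ?_, ?_, ?_, ?_, ?_⟩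
  · have h1 : ContDiff ℝ 1 (deriv x) := by
      rw [contDiff_one_iff_deriv]
      refine ⟨fun t => (hdxder t).differentiableAt, ?_⟩
      rw [hdd]
      fun_prop
    have : ContDiff ℝ (1 + 1) x := by
      rw [contDiff_succ_iff_deriv]
      exact ⟨fun t => (hxder t).differentiableAt, by simp, h1⟩
    simpa [one_add_one_eq_two] using this
  · intro t
    rw [hdd]
    have h1 : x t ^ 2 = g (φ t) := hrsq _
    have h2 : x t ^ 3 = g (φ t) * x t := by rw [← h1]; ring
    simp only [h2, hg, delaunayGamma]
    have h3 := Real.sin_sq_add_cos_sq (φ t)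
    have h4 : Real.sin (φ t) ^ 2 = 1 - Real.cos (φ t) ^ 2 := by linarith
    rw [h4]
    ring
  · simp only [hx, hφ0, hr, hg]
    simp [Real.sqrt_sq ha1.le]
  · rw [hdx]
    simp [hφ0]
  · intro t
    exact intervalIntegral.integral_hasDerivAt_right (hgc.intervalIntegrable _ _)
      (hgc.stronglyMeasurableAtFilter _ _) hgc.continuousAt
  · simp

/-- The solution `(x_a, z_a)` of the initial value problem (unique by Cauchy–Lipschitz). -/
noncomputable def delaunayProfile (a : ℝ) : (ℝ → ℝ) × (ℝ → ℝ) :=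
  Classical.epsilon fun p => IsDelaunayProfile a p.1 p.2

/-- The radius function `x_a`. -/
noncomputable def delaunayX (a : ℝ) : ℝ → ℝ := (delaunayProfile a).1

/-- The height function `z_a`. -/
noncomputable def delaunayZ (a : ℝ) : ℝ → ℝ := (delaunayProfile a).2

theorem isDelaunayProfile {a : ℝ} (ha : a ∈ delaunayParams) :
    IsDelaunayProfile a (delaunayX a) (delaunayZ a) := by
  obtain ⟨x, z, h⟩ := exists_isDelaunayProfile ha
  exact Classical.epsilon_spec
    (p := fun p : (ℝ → ℝ) × (ℝ → ℝ) => IsDelaunayProfile a p.1 p.2) ⟨(x, z), h⟩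

/-- `τ_a`: half of the least positive period of `x_a` (not meaningful for `a = -1/2`,
where `x_a` is constant). -/
noncomputable def delaunayTau (a : ℝ) : ℝ :=
  sInf {P : ℝ | 0 < P ∧ Function.Periodic (delaunayX a) P} / 2

/-! Functions and surfaces on `I × 𝕊¹`, with `𝕊¹ = ℝ / 2πℤ`, are written as functions of
`(t, θ) ∈ ℝ × ℝ`, `2π`-periodic in `θ`; only their values for `t ∈ I` matter. Derivatives in `t`
are taken within `I`, so they are one-sided at an end point of `I`. -/

/-- Partial derivative in `t` within `I`. -/
noncomputable def partialT {E : Type*} [NormedAddCommGroup E] [NormedSpace ℝ E] (I : Set ℝ)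
    (f : ℝ → ℝ → E) (t θ : ℝ) : E :=
  derivWithin (fun s => f s θ) I t

/-- Partial derivative in `θ`. -/
noncomputable def partialTheta {E : Type*} [NormedAddCommGroup E] [NormedSpace ℝ E]
    (f : ℝ → ℝ → E) (t θ : ℝ) : E :=
  deriv (fun s => f t s) θ

/-- The unit normal `X_t ∧ X_θ / |X_t ∧ X_θ|` (Euclidean length). -/
noncomputable def unitNormal (I : Set ℝ) (X : ℝ → ℝ → Fin 3 → ℝ) (t θ : ℝ) : Fin 3 → ℝ :=
  let n := partialT I X t θ ⨯₃ partialTheta X t θ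
  (√(n ⬝ᵥ n))⁻¹ • n

/-- The mean curvature `(E N - 2 F M + G L) / (2 (E G - F²))` of a parametric surface. -/
noncomputable def meanCurvature (I : Set ℝ) (X : ℝ → ℝ → Fin 3 → ℝ) (t θ : ℝ) : ℝ :=
  let Xt := partialT I X t θ
  let Xθ := partialTheta X t θ
  let ν := unitNormal I X t θ
  let E := Xt ⬝ᵥ Xt
  let F := Xt ⬝ᵥ Xθ
  let G := Xθ ⬝ᵥ Xθ
  let L := partialT I (partialT I X) t θ ⬝ᵥ ν
  let M := partialTheta (partialT I X) t θ ⬝ᵥ ν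
  let N := partialTheta (partialTheta X) t θ ⬝ᵥ ν
  (E * N - 2 * F * M + G * L) / (2 * (E * G - F ^ 2))

/-- The Delaunay surface `X_a`. -/
noncomputable def delaunaySurface (a : ℝ) (t θ : ℝ) : Fin 3 → ℝ :=
  ![delaunayX a t * Real.cos θ, delaunayX a t * Real.sin θ, delaunayZ a t]

/-- The normal graph `X_a + φ N_a`. -/
noncomputable def normalGraph (a : ℝ) (φ : ℝ → ℝ → ℝ) (t θ : ℝ) : Fin 3 → ℝ :=
  delaunaySurface a t θ + φ t θ • unitNormal univ (delaunaySurface a) t θ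

/-- `𝔏_a φ = 0` on `I × 𝕊¹`: at every point, the derivative at `s = 0` of the mean curvature of
`X_a + s φ N_a` exists and vanishes. -/
def JacobiEq (I : Set ℝ) (a : ℝ) (φ : ℝ → ℝ → ℝ) : Prop :=
  ∀ t ∈ I, ∀ θ : ℝ,
    HasDerivAt (fun s : ℝ => meanCurvature I (normalGraph a fun t θ => s * φ t θ) t θ) 0 0

/-- `φ ∈ C^{2,α}(I × 𝕊¹)`, for a compact interval `I`: `φ` is `2π`-periodic in `θ`, of class `C²`
(up to the boundary), and its second derivatives are `α`-Hölder continuous. -/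
structure IsC2Holder (α : ℝ≥0) (I : Set ℝ) (φ : ℝ → ℝ → ℝ) : Prop where
  periodic : ∀ t ∈ I, Function.Periodic (φ t) (2 * Real.pi)
  contDiffOn : ContDiffOn ℝ 2 (Function.uncurry φ) (I ×ˢ univ)
  holder_tt : ∃ C, HolderOnWith C α (Function.uncurry (partialT I (partialT I φ))) (I ×ˢ univ)
  holder_tθ : ∃ C, HolderOnWith C α (Function.uncurry (partialTheta (partialT I φ))) (I ×ˢ univ)
  holder_θθ : ∃ C, HolderOnWith C α (Function.uncurry (partialTheta (partialTheta φ))) (I ×ˢ univ)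

/-- The space `𝒳_T` of `C^{2,α}` functions on `[-T, T] × 𝕊¹` that vanish at `t = ±T` and are even
in `t`. -/
structure MemX (α : ℝ≥0) (T : ℝ) (φ : ℝ → ℝ → ℝ) : Prop where
  isC2Holder : IsC2Holder α (Icc (-T) T) φ
  boundary : ∀ θ, φ T θ = 0 ∧ φ (-T) θ = 0
  even : ∀ t ∈ Icc (-T) T, ∀ θ, φ t θ = φ (-t) θ

/-- `𝒯_a`: the `T > 0` for which `𝔏_a` has a nontrivial kernel in `𝒳_T`. -/
def degeneracySet (α : ℝ≥0) (a : ℝ) : Set ℝ :=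
  {T | 0 < T ∧ ∃ φ : ℝ → ℝ → ℝ, MemX α T φ ∧ JacobiEq (Icc (-T) T) a φ ∧
    ∃ t ∈ Icc (-T) T, ∃ θ, φ t θ ≠ 0}

/-- `𝒯_{a,j}`: the `T > 0` for which there is a non-null `C²` solution `φ(t, θ) = w(t) cos(jθ)`,
`w` even, of `𝔏_a φ = 0` on `ℝ × 𝕊¹` with `φ(T, ·) = 0`. -/
def modeDegeneracySet (a : ℝ) (j : ℕ) : Set ℝ :=
  {T | 0 < T ∧ ∃ (φ : ℝ → ℝ → ℝ) (w : ℝ → ℝ), Function.Even w ∧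
    (∀ t θ, φ t θ = w t * Real.cos (j * θ)) ∧
    ContDiff ℝ 2 (Function.uncurry φ) ∧ φ ≠ 0 ∧ JacobiEq univ a φ ∧ ∀ θ, φ T θ = 0}

/-! Write `x = x_a`, `γ = γ_a`. The quantity `x'² - x² + (x² - γ)²` is conserved, so the
parametrization of the Delaunay surface is conformal with factor `x²`, and the first variation of
the mean curvature in the direction `φ N_a` is `(φ_tt + φ_θθ + p φ) / (2 x²)` with
`p = 2 (x² + γ² / x²)` (`hasDerivAt_meanCurvature_normalGraph`). A Jacobi function in `𝒳_T` splits
into Fourier modes in `θ`; each coefficient is even in `t`, vanishes at `T`, and solves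
`w'' = (j² - p) w`, hence is a multiple of the even solution `w_j` with `w_j(0) = 1`. So both
`𝒯_a` and the sets `𝒯_{a,j}` are described by the positive zeros of the functions `w_j`
(`modeDegeneracySet_eq`, `degeneracySet_eq_iUnion`).

The zeros of `w_j` come from explicit solutions and Sturm comparison.

* `j = 1`: `w_1 = x - γ / x`, from the horizontal translations. It is positive if `a < 0`; if `a > 0`
  it vanishes exactly at the odd multiples of `τ / 2`, because `x(t + τ) = |γ| / x(t)`.
* `j = 0`: `u = x' / x`, from the vertical translations, is the odd solution, with zeros `k τ`. The
  function `x - |γ| / x` solves `h'' = (κ - p) h` with `κ > 0` and first vanishes at `τ / 2`, so `w_0`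
  has a zero before `τ / 2`. Since `p` has period `τ`, the shift of `w_0` by `τ` is `-w_0 + B u`, which
  gives `w_0((k + 1/2) τ) = (-1)^k (2 k + 1) w_0(τ / 2)` and hence a zero in each interval
  `(k τ, (k + 1/2) τ)`. The quotient `w_0 / u` is monotone between zeros of `u`, so there is no other.
* `j ≥ 2`: if `a < 0`, comparison with `w_1 > 0` excludes zeros; if `γ ≤ 1/2`, then `p ≤ 4 ≤ j²`
  does, by comparison with a constant. As `p ≥ 4 γ`, comparison with the cosine gives a zero as soon
  as `a` is large. -/

/-! ### Linear second order equations `w'' = q w` -/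

/-- `w` solves `w'' = q w` on `s`, with derivative `dw`. -/
def SolvesOn (q w dw : ℝ → ℝ) (s : Set ℝ) : Prop :=
  ∀ t ∈ s, HasDerivAt w (dw t) t ∧ HasDerivAt dw (q t * w t) t

theorem SolvesOn.mono {q w dw : ℝ → ℝ} {s r : Set ℝ} (h : SolvesOn q w dw s) (hr : r ⊆ s) :
    SolvesOn q w dw r := fun t ht => h t (hr ht)

theorem SolvesOn.const_mul {q w dw : ℝ → ℝ} {s : Set ℝ} (h : SolvesOn q w dw s) (c : ℝ) :
    SolvesOn q (fun t => c * w t) (fun t => c * dw t) s := fun t ht =>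
  ⟨(h t ht).1.const_mul c, ((h t ht).2.const_mul c).congr_deriv (by ring)⟩

theorem SolvesOn.add {q w dw v dv : ℝ → ℝ} {s : Set ℝ} (h : SolvesOn q w dw s)
    (h' : SolvesOn q v dv s) :
    SolvesOn q (fun t => w t + v t) (fun t => dw t + dv t) s := fun t ht =>
  ⟨(h t ht).1.add (h' t ht).1, ((h t ht).2.add (h' t ht).2).congr_deriv (by ring)⟩

theorem SolvesOn.sub {q w dw v dv : ℝ → ℝ} {s : Set ℝ} (h : SolvesOn q w dw s)
    (h' : SolvesOn q v dv s) :
    SolvesOn q (fun t => w t - v t) (fun t => dw t - dv t) s := fun t ht =>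
  ⟨(h t ht).1.sub (h' t ht).1, ((h t ht).2.sub (h' t ht).2).congr_deriv (by ring)⟩

theorem SolvesOn.comp_add_const {q w dw : ℝ → ℝ} (h : SolvesOn q w dw univ) (c : ℝ) :
    SolvesOn (fun t => q (t + c)) (fun t => w (t + c)) (fun t => dw (t + c)) univ := fun t _ =>
  ⟨(h (t + c) trivial).1.comp_add_const t c, (h (t + c) trivial).2.comp_add_const t c⟩

theorem SolvesOn.comp_const_sub {q w dw : ℝ → ℝ} (h : SolvesOn q w dw univ) (c : ℝ) :
    SolvesOn (fun t => q (c - t)) (fun t => w (c - t)) (fun t => -dw (c - t)) univ := fun t _ => by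
  refine ⟨(h (c - t) trivial).1.comp_const_sub c t, ?_⟩
  exact ((h (c - t) trivial).2.comp_const_sub c t).neg.congr_deriv (neg_neg _)

theorem SolvesOn.eqOn_Ioo {q w dw v dv : ℝ → ℝ} {l r t₀ K : ℝ} (ht₀ : t₀ ∈ Ioo l r)
    (hq : ∀ t ∈ Ioo l r, |q t| ≤ K) (hw : SolvesOn q w dw (Ioo l r))
    (hv : SolvesOn q v dv (Ioo l r)) (h0 : w t₀ = v t₀) (h1 : dw t₀ = dv t₀) :
    EqOn w v (Ioo l r) ∧ EqOn dw dv (Ioo l r) := by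
  have key : EqOn (fun t => (w t, dw t)) (fun t => (v t, dv t)) (Ioo l r) := by
    refine ODE_solution_unique_of_mem_Ioo (v := fun t (y : ℝ × ℝ) => (y.2, q t * y.1))
      (s := fun _ => univ) (K := Real.toNNReal (max 1 K)) ?_ ht₀
      (fun t ht => ⟨(hw t ht).1.prodMk (hw t ht).2, trivial⟩)
      (fun t ht => ⟨(hv t ht).1.prodMk (hv t ht).2, trivial⟩) (by simp [h0, h1])
    intro t ht
    refine LipschitzWith.lipschitzOnWith (LipschitzWith.of_dist_le_mul fun y z => ?_)
    rw [Real.coe_toNNReal _ (le_trans zero_le_one (le_max_left _ _)), Prod.dist_eq, Prod.dist_eq]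
    simp only [Real.dist_eq]
    have hm : 1 ≤ max 1 K := le_max_left _ _
    refine max_le ?_ ?_
    · calc |y.2 - z.2| ≤ max |y.1 - z.1| |y.2 - z.2| := le_max_right _ _
        _ ≤ _ := le_mul_of_one_le_left (le_max_of_le_left (abs_nonneg _)) hm
    · rw [← mul_sub, abs_mul]
      exact mul_le_mul ((hq t ht).trans (le_max_right _ _)) (le_max_left _ _) (abs_nonneg _)
        (le_trans zero_le_one hm)
  exact ⟨fun t ht => congrArg Prod.fst (key ht), fun t ht => congrArg Prod.snd (key ht)⟩

theorem SolvesOn.eq {q w dw v dv : ℝ → ℝ} (hq : Continuous q) (hw : SolvesOn q w dw univ)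
    (hv : SolvesOn q v dv univ) (t₀ : ℝ) (h0 : w t₀ = v t₀) (h1 : dw t₀ = dv t₀) :
    w = v ∧ dw = dv := by
  have key : ∀ t, w t = v t ∧ dw t = dv t := by
    intro t
    obtain ⟨K, hK⟩ := (isCompact_Icc (a := min t t₀ - 1) (b := max t t₀ + 1)).exists_bound_of_continuousOn
      hq.continuousOn
    have hmem : ∀ s, min t t₀ ≤ s → s ≤ max t t₀ → s ∈ Ioo (min t t₀ - 1) (max t t₀ + 1) :=
      fun s h h' => ⟨by linarith, by linarith⟩
    have := SolvesOn.eqOn_Ioo (hmem t₀ (min_le_right _ _) (le_max_right _ _))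
      (fun s hs => hK s (Ioo_subset_Icc_self hs)) (hw.mono (subset_univ _))
      (hv.mono (subset_univ _)) h0 h1
    exact ⟨this.1 (hmem t (min_le_left _ _) (le_max_left _ _)),
      this.2 (hmem t (min_le_left _ _) (le_max_left _ _))⟩
  exact ⟨funext fun t => (key t).1, funext fun t => (key t).2⟩

/-- A convex function with a critical point at `0` is minimal there. -/
theorem le_of_second_deriv_nonneg {f df ddf : ℝ → ℝ} (h1 : ∀ t, HasDerivAt f (df t) t)
    (h2 : ∀ t, HasDerivAt df (ddf t) t) (h3 : ∀ t, 0 ≤ ddf t) (h0 : df 0 = 0) (t : ℝ) :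
    f 0 ≤ f t := by
  have hmono : Monotone df := monotone_of_deriv_nonneg (fun t => (h2 t).differentiableAt)
    fun t => by rw [(h2 t).deriv]; exact h3 t
  have hc : Continuous f := continuous_iff_continuousAt.2 fun t => (h1 t).continuousAt
  rcases le_total 0 t with ht | ht
  · refine monotoneOn_of_deriv_nonneg (convex_Ici 0) hc.continuousOn
      (fun t _ => (h1 t).differentiableAt.differentiableWithinAt) ?_ self_mem_Ici ht ht
    intro s hs
    rw [interior_Ici] at hs
    rw [(h1 s).deriv, ← h0]
    exact hmono (le_of_lt hs)
  · refine antitoneOn_of_deriv_nonpos (convex_Iic 0) hc.continuousOn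
      (fun t _ => (h1 t).differentiableAt.differentiableWithinAt) ?_ ht self_mem_Iic ht
    intro s hs
    rw [interior_Iic] at hs
    rw [(h1 s).deriv, ← h0]
    exact hmono (le_of_lt hs)

theorem hasDerivAt_integral_zero {g : ℝ → ℝ} (hg : Continuous g) (t : ℝ) :
    HasDerivAt (fun t => ∫ s in (0 : ℝ)..t, g s) (g t) t :=
  intervalIntegral.integral_hasDerivAt_right (hg.intervalIntegrable _ _)
    (hg.stronglyMeasurableAtFilter _ _) hg.continuousAt

/-- The twice iterated primitive of `g`, with vanishing value and derivative at `0`. -/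
noncomputable def doublePrimitive (g : ℝ → ℝ) (t : ℝ) : ℝ :=
  ∫ s in (0 : ℝ)..t, ∫ r in (0 : ℝ)..s, g r

theorem hasDerivAt_doublePrimitive {g : ℝ → ℝ} (hg : Continuous g) (t : ℝ) :
    HasDerivAt (doublePrimitive g) (∫ r in (0 : ℝ)..t, g r) t :=
  hasDerivAt_integral_zero
    (continuous_iff_continuousAt.2 fun t => (hasDerivAt_integral_zero hg t).continuousAt) t

theorem abs_doublePrimitive_sub_le {g h : ℝ → ℝ} (hg : Continuous g) (hh : Continuous h)
    {M k : ℝ} (hb : ∀ t, |g t - h t| ≤ M * k ^ 2 * Real.cosh (k * t)) (t : ℝ) :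
    |doublePrimitive g t - doublePrimitive h t| ≤ M * (Real.cosh (k * t) - 1) := by
  have hc1 : ∀ t, HasDerivAt (fun t => M * Real.cosh (k * t)) (M * k * Real.sinh (k * t)) t :=
    fun t => by
      have := (((hasDerivAt_id t).const_mul k).cosh).const_mul M
      refine this.congr_deriv ?_
      simp; ring
  have hc2 : ∀ t, HasDerivAt (fun t => M * k * Real.sinh (k * t))
      (M * k ^ 2 * Real.cosh (k * t)) t := fun t => by
    have := (((hasDerivAt_id t).const_mul k).sinh).const_mul (M * k)
    refine this.congr_deriv ?_
    simp; ring
  have e1 := le_of_second_deriv_nonneg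
    (fun t => (hc1 t).sub ((hasDerivAt_doublePrimitive hg t).sub (hasDerivAt_doublePrimitive hh t)))
    (fun t => (hc2 t).sub ((hasDerivAt_integral_zero hg t).sub (hasDerivAt_integral_zero hh t)))
    (fun t => by linarith [(abs_le.1 (hb t)).2]) (by simp) t
  have e2 := le_of_second_deriv_nonneg
    (fun t => (hc1 t).add ((hasDerivAt_doublePrimitive hg t).sub (hasDerivAt_doublePrimitive hh t)))
    (fun t => (hc2 t).add ((hasDerivAt_integral_zero hg t).sub (hasDerivAt_integral_zero hh t)))
    (fun t => by linarith [(abs_le.1 (hb t)).1]) (by simp) t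
  simp only [Pi.sub_apply, Pi.add_apply, doublePrimitive, intervalIntegral.integral_same, mul_zero, Real.cosh_zero] at e1 e2
  rw [abs_le]
  simp only [doublePrimitive]
  constructor <;> linarith

/-- Global solvability of `w'' = q w` for bounded continuous `q`: the integral equation
`w = 1 + ∬ q w` is a contraction in the sup norm weighted by `1 / cosh (k t)`, `k² = 2 sup |q|`. -/
theorem exists_solvesOn {q : ℝ → ℝ} (hq : Continuous q) {K : ℝ} (hK : ∀ t, |q t| ≤ K) :
    ∃ w dw : ℝ → ℝ, SolvesOn q w dw univ ∧ w 0 = 1 ∧ dw 0 = 0 := by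
  have hK0 : 0 ≤ K := (abs_nonneg _).trans (hK 0)
  set k : ℝ := Real.sqrt (2 * K) with hk
  have hk2 : k ^ 2 = 2 * K := Real.sq_sqrt (by positivity)
  set c : ℝ → ℝ := fun t => Real.cosh (k * t) with hcdef
  have hc : Continuous c := by fun_prop
  have hc1 : ∀ t, 1 ≤ c t := fun t => Real.one_le_cosh _
  have hcpos : ∀ t, 0 < c t := fun t => one_pos.trans_le (hc1 t)
  set g : BoundedContinuousFunction ℝ ℝ → ℝ → ℝ := fun f t => q t * (c t * f t) with hgdef
  have hg : ∀ f, Continuous (g f) := fun f => hq.mul (hc.mul f.continuous)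
  have hbound : ∀ f f' : BoundedContinuousFunction ℝ ℝ, ∀ t,
      |doublePrimitive (g f) t - doublePrimitive (g f') t| ≤ (dist f f' / 2) * (c t - 1) := by
    intro f f' t
    refine abs_doublePrimitive_sub_le (hg f) (hg f') (fun t => ?_) t
    have h1 : g f t - g f' t = q t * (c t * (f t - f' t)) := by simp only [hgdef]; ring
    rw [h1, abs_mul, abs_mul, abs_of_pos (hcpos t), hk2]
    have h2 : |f t - f' t| ≤ dist f f' := by
      rw [← Real.dist_eq]; exact BoundedContinuousFunction.dist_coe_le_dist t
    calc |q t| * (c t * |f t - f' t|) ≤ K * (c t * dist f f') := by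
          gcongr
          exact hK t
      _ = _ := by simp only [hcdef]; ring
  have hg0 : g 0 = 0 := by funext t; simp [hgdef]
  have hcontV : ∀ f, Continuous (doublePrimitive (g f)) := fun f =>
    continuous_iff_continuousAt.2 fun t => (hasDerivAt_doublePrimitive (hg f) t).continuousAt
  have hVb : ∀ f : BoundedContinuousFunction ℝ ℝ, ∀ t,
      ‖(1 + doublePrimitive (g f) t) / c t‖ ≤ 1 + dist f 0 / 2 := by
    intro f t
    have h1 := hbound f 0 t
    rw [hg0] at h1
    have h0 : doublePrimitive 0 t = 0 := by simp [doublePrimitive]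
    rw [h0, sub_zero] at h1
    rw [Real.norm_eq_abs, abs_div, abs_of_pos (hcpos t), div_le_iff₀ (hcpos t)]
    have h2 := abs_add_le 1 (doublePrimitive (g f) t)
    rw [abs_one] at h2
    have := hc1 t
    have hd : 0 ≤ dist f 0 := dist_nonneg
    nlinarith
  set S : BoundedContinuousFunction ℝ ℝ → BoundedContinuousFunction ℝ ℝ := fun f =>
    BoundedContinuousFunction.ofNormedAddCommGroup (fun t => (1 + doublePrimitive (g f) t) / c t)
      ((continuous_const.add (hcontV f)).div hc fun t => (hcpos t).ne') _ (hVb f) with hS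
  have hSapp : ∀ f t, S f t = (1 + doublePrimitive (g f) t) / c t := fun f t => rfl
  have hcontr : ContractingWith (1 / 2) S := by
    refine ⟨by rw [← NNReal.coe_lt_coe]; norm_num, LipschitzWith.of_dist_le_mul fun f f' => ?_⟩
    rw [BoundedContinuousFunction.dist_le (by positivity)]
    intro t
    rw [hSapp, hSapp, Real.dist_eq, ← sub_div, abs_div, abs_of_pos (hcpos t),
      div_le_iff₀ (hcpos t)]
    have h1 := hbound f f' t
    have h2 : 0 ≤ dist f f' := dist_nonneg
    have h3 : ((1 / 2 : ℝ≥0) : ℝ) = 1 / 2 := by norm_num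
    rw [h3, add_sub_add_left_eq_sub]
    nlinarith
  set f := hcontr.fixedPoint
  have hfix : S f = f := hcontr.fixedPoint_isFixedPt
  have hw : ∀ t, c t * f t = 1 + doublePrimitive (g f) t := by
    intro t
    have h := hSapp f t
    rw [hfix] at h
    rw [h, mul_div_cancel₀ _ (hcpos t).ne']
  refine ⟨fun t => 1 + doublePrimitive (g f) t, fun t => ∫ r in (0 : ℝ)..t, g f r,
    fun t _ => ⟨(hasDerivAt_doublePrimitive (hg f) t).const_add 1, ?_⟩, ?_, ?_⟩
  · beta_reduce
    rw [← hw t]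
    exact hasDerivAt_integral_zero (hg f) t
  · simp [doublePrimitive]
  · simp

/-- The Wronskian of `w'' = q w` and `v'' = r v` has derivative `(q - r) w v`. -/
theorem SolvesOn.hasDerivAt_wronskian {q r w dw v dv : ℝ → ℝ} {s : Set ℝ} (hw : SolvesOn q w dw s)
    (hv : SolvesOn r v dv s) {t : ℝ} (ht : t ∈ s) :
    HasDerivAt (fun t => dw t * v t - w t * dv t) ((q t - r t) * (w t * v t)) t :=
  (((hw t ht).2.mul (hv t ht).1).sub ((hw t ht).1.mul (hv t ht).2)).congr_deriv (by ring)

theorem SolvesOn.continuous {q w dw : ℝ → ℝ} (h : SolvesOn q w dw univ) : Continuous w :=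
  continuous_iff_continuousAt.2 fun t => (h t trivial).1.continuousAt

theorem SolvesOn.continuous_deriv {q w dw : ℝ → ℝ} (h : SolvesOn q w dw univ) : Continuous dw :=
  continuous_iff_continuousAt.2 fun t => (h t trivial).2.continuousAt

theorem SolvesOn.wronskian_eq {q w dw v dv : ℝ → ℝ} (hw : SolvesOn q w dw univ)
    (hv : SolvesOn q v dv univ) (s t : ℝ) :
    dw s * v s - w s * dv s = dw t * v t - w t * dv t := by
  refine is_const_of_deriv_eq_zero (f := fun t => dw t * v t - w t * dv t)
    (fun t => (hw.hasDerivAt_wronskian hv (mem_univ t)).differentiableAt) (fun t => ?_) s t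
  rw [(hw.hasDerivAt_wronskian hv (mem_univ t)).deriv]
  ring

theorem SolvesOn.even {q w dw : ℝ → ℝ} (hq : Continuous q) (he : Function.Even q)
    (hw : SolvesOn q w dw univ) (h0 : dw 0 = 0) : Function.Even w := by
  have h := hw.comp_const_sub 0
  have hq' : (fun t => q (0 - t)) = q := by funext t; rw [zero_sub, he]
  rw [hq'] at h
  have := (SolvesOn.eq hq h hw 0 (by simp) (by simp [h0])).1
  intro t
  simpa using congrFun this t

theorem deriv_zero_of_eventually_even {w : ℝ → ℝ} {c : ℝ} (he : ∀ᶠ t in 𝓝 0, w (-t) = w t)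
    (h : HasDerivAt w c 0) : c = 0 := by
  have h' := HasDerivAt.comp_const_sub 0 0 (f := w) (f' := c) (by simpa using h)
  have h2 : w =ᶠ[𝓝 0] fun x => w (0 - x) := by
    filter_upwards [he] with t ht
    rw [zero_sub, ht]
  linarith [h.unique (h'.congr_of_eventuallyEq h2)]

theorem SolvesOn.eq_smul_of_even {q w dw v dv : ℝ → ℝ} (hq : Continuous q)
    (hw : SolvesOn q w dw univ) (hv : SolvesOn q v dv univ) (hv0 : v 0 = 1) (hdv : dv 0 = 0)
    (he : Function.Even w) (t : ℝ) : w t = w 0 * v t :=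
  congrFun (SolvesOn.eq hq hw (hv.const_mul (w 0)) 0 (by simp [hv0])
    (by simp [hdv, deriv_zero_of_eventually_even (Eventually.of_forall he) (hw 0 trivial).1])).1 t

/-! ### The Delaunay profile -/

section Profile

variable {a : ℝ}

theorem one_add_pos_of_mem (ha : a ∈ delaunayParams) : 0 < 1 + a := by
  rcases ha with h | h
  · linarith [h.1]
  · linarith [mem_Ioi.1 h]

theorem ne_zero_of_mem (ha : a ∈ delaunayParams) : a ≠ 0 := by
  rcases ha with h | h
  · exact h.2.ne
  · exact (mem_Ioi.1 h).ne'

theorem delaunayGamma_ne_zero (ha : a ∈ delaunayParams) : delaunayGamma a ≠ 0 :=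
  mul_ne_zero (ne_zero_of_mem ha) (one_add_pos_of_mem ha).ne'

theorem hasDerivAt_delaunayX (ha : a ∈ delaunayParams) (t : ℝ) :
    HasDerivAt (delaunayX a) (deriv (delaunayX a) t) t :=
  ((isDelaunayProfile ha).contDiff_x.differentiable (by norm_num) t).hasDerivAt

theorem hasDerivAt_deriv_delaunayX (ha : a ∈ delaunayParams) (t : ℝ) :
    HasDerivAt (deriv (delaunayX a))
      ((1 + 2 * delaunayGamma a) * delaunayX a t - 2 * delaunayX a t ^ 3) t := by
  rw [← (isDelaunayProfile ha).ode_x t]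
  have h : ContDiff ℝ 1 (deriv (delaunayX a)) :=
    ((contDiff_succ_iff_deriv (n := 1)).1 (by
      simpa [one_add_one_eq_two] using (isDelaunayProfile ha).contDiff_x)).2.2
  exact (h.differentiable one_ne_zero t).hasDerivAt

theorem continuous_delaunayX (ha : a ∈ delaunayParams) : Continuous (delaunayX a) :=
  (isDelaunayProfile ha).contDiff_x.continuous

/-- Conservation law of the profile equation: `x'² + z'² = x²`, so `X_a` is conformal. -/
theorem deriv_delaunayX_sq (ha : a ∈ delaunayParams) (t : ℝ) :
    deriv (delaunayX a) t ^ 2 = delaunayX a t ^ 2 - (delaunayX a t ^ 2 - delaunayGamma a) ^ 2 := by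
  have hd : ∀ t, HasDerivAt (fun t => deriv (delaunayX a) t ^ 2 -
      (delaunayX a t ^ 2 - (delaunayX a t ^ 2 - delaunayGamma a) ^ 2)) 0 t := by
    intro t
    have h1 := hasDerivAt_delaunayX ha t
    have h := ((hasDerivAt_deriv_delaunayX ha t).pow 2).sub
      ((h1.pow 2).sub (((h1.pow 2).sub_const (delaunayGamma a)).pow 2))
    refine h.congr_deriv ?_
    simp only [Nat.cast_ofNat, Nat.add_one_sub_one, pow_one, Pi.pow_apply]
    ring
  have h := is_const_of_deriv_eq_zero (fun t => (hd t).differentiableAt) (fun t => (hd t).deriv) t 0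
  simp only [(isDelaunayProfile ha).x_zero, (isDelaunayProfile ha).deriv_x_zero] at h
  have h2 : (0 : ℝ) ^ 2 - ((1 + a) ^ 2 - ((1 + a) ^ 2 - delaunayGamma a) ^ 2) = 0 := by
    simp only [delaunayGamma]; ring
  rw [h2] at h
  linarith

theorem delaunayX_pos (ha : a ∈ delaunayParams) (t : ℝ) : 0 < delaunayX a t := by
  have hne : ∀ t, delaunayX a t ≠ 0 := by
    intro t h0
    have h := deriv_delaunayX_sq ha t
    rw [h0] at h
    have h1 : 0 < delaunayGamma a ^ 2 := by have := delaunayGamma_ne_zero ha; positivity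
    nlinarith [sq_nonneg (deriv (delaunayX a) t)]
  by_contra hcon
  have h0 : delaunayX a 0 = 1 + a := (isDelaunayProfile ha).x_zero
  obtain ⟨s, hs⟩ := mem_range_of_exists_le_of_exists_ge (continuous_delaunayX ha)
    ⟨t, not_lt.1 hcon⟩ ⟨0, by rw [h0]; exact (one_add_pos_of_mem ha).le⟩
  exact hne s hs

/-- Uniqueness for `y'' = c y - 2 y³`: the difference of two solutions solves a linear equation. -/
theorem duffing_unique {c : ℝ} {y dy z dz : ℝ → ℝ} (hy : ∀ t, HasDerivAt y (dy t) t)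
    (hdy : ∀ t, HasDerivAt dy (c * y t - 2 * y t ^ 3) t) (hz : ∀ t, HasDerivAt z (dz t) t)
    (hdz : ∀ t, HasDerivAt dz (c * z t - 2 * z t ^ 3) t) (t₀ : ℝ) (h0 : y t₀ = z t₀)
    (h1 : dy t₀ = dz t₀) : y = z := by
  have hyc : Continuous y := continuous_iff_continuousAt.2 fun t => (hy t).continuousAt
  have hzc : Continuous z := continuous_iff_continuousAt.2 fun t => (hz t).continuousAt
  have hs : SolvesOn (fun t => c - 2 * (y t ^ 2 + y t * z t + z t ^ 2)) (fun t => y t - z t)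
      (fun t => dy t - dz t) univ := fun t _ =>
    ⟨(hy t).sub (hz t), ((hdy t).sub (hdz t)).congr_deriv (by ring)⟩
  have hzero : SolvesOn (fun t => c - 2 * (y t ^ 2 + y t * z t + z t ^ 2)) (fun _ => 0)
      (fun _ => 0) univ := fun t _ =>
    ⟨hasDerivAt_const _ _, (hasDerivAt_const _ _).congr_deriv (by ring)⟩
  have h := (SolvesOn.eq (by fun_prop) hs hzero t₀ (by simp [h0]) (by simp [h1])).1
  funext t
  exact sub_eq_zero.1 (congrFun h t)

theorem delaunayX_even (ha : a ∈ delaunayParams) : Function.Even (delaunayX a) := by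
  have h := duffing_unique (c := 1 + 2 * delaunayGamma a) (y := fun t => delaunayX a (0 - t))
    (dy := fun t => -deriv (delaunayX a) (0 - t))
    (fun t => (hasDerivAt_delaunayX ha (0 - t)).comp_const_sub 0 t)
    (fun t => ((hasDerivAt_deriv_delaunayX ha (0 - t)).comp_const_sub 0 t).neg.congr_deriv
      (neg_neg _))
    (hasDerivAt_delaunayX ha) (hasDerivAt_deriv_delaunayX ha) 0 (by simp)
    (by simp [(isDelaunayProfile ha).deriv_x_zero])
  intro t
  simpa using congrFun h t

/-- The amplitude: the primitive of `x_a` vanishing at `0`. -/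
noncomputable def delaunayAngle (a : ℝ) (t : ℝ) : ℝ := ∫ s in (0 : ℝ)..t, delaunayX a s

theorem hasDerivAt_delaunayAngle (ha : a ∈ delaunayParams) (t : ℝ) :
    HasDerivAt (delaunayAngle a) (delaunayX a t) t :=
  hasDerivAt_integral_zero (continuous_delaunayX ha) t

theorem delaunayAngle_zero : delaunayAngle a 0 = 0 := by simp [delaunayAngle]

theorem delaunayAngle_strictMono (ha : a ∈ delaunayParams) : StrictMono (delaunayAngle a) :=
  strictMono_of_deriv_pos fun t => by
    rw [(hasDerivAt_delaunayAngle ha t).deriv]; exact delaunayX_pos ha t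

/-- The pair `(x', x² - γ - 1/2)` rotates with angular speed `2 x`, that is, by the angle `2 ψ`. -/
theorem delaunay_amplitude (ha : a ∈ delaunayParams) (t : ℝ) :
    deriv (delaunayX a) t = -((1 + 2 * a) / 2) * Real.sin (2 * delaunayAngle a t) ∧
    delaunayX a t ^ 2 = delaunayGamma a + 1 / 2 +
      (1 + 2 * a) / 2 * Real.cos (2 * delaunayAngle a t) := by
  set x := delaunayX a
  set ψ := delaunayAngle a with hψ
  set g := delaunayGamma a
  have hs : ∀ t, HasDerivAt (fun t => Real.sin (2 * ψ t))
      (Real.cos (2 * ψ t) * (2 * x t)) t := fun t =>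
    ((hasDerivAt_delaunayAngle ha t).const_mul 2).sin
  have hc : ∀ t, HasDerivAt (fun t => Real.cos (2 * ψ t))
      (-Real.sin (2 * ψ t) * (2 * x t)) t := fun t =>
    ((hasDerivAt_delaunayAngle ha t).const_mul 2).cos
  have hB : ∀ t, HasDerivAt (fun t => x t ^ 2 - g - 1 / 2) (2 * x t * deriv x t) t := fun t =>
    ((((hasDerivAt_delaunayX ha t).pow 2).sub_const _).sub_const _).congr_deriv (by norm_num; rfl)
  have hA := hasDerivAt_deriv_delaunayX ha
  have h1 : ∀ t, HasDerivAt (fun t => deriv x t * Real.cos (2 * ψ t) +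
      (x t ^ 2 - g - 1 / 2) * Real.sin (2 * ψ t)) 0 t := fun t =>
    (((hA t).mul (hc t)).add ((hB t).mul (hs t))).congr_deriv (by ring)
  have h2 : ∀ t, HasDerivAt (fun t => (x t ^ 2 - g - 1 / 2) * Real.cos (2 * ψ t) -
      deriv x t * Real.sin (2 * ψ t)) 0 t := fun t =>
    (((hB t).mul (hc t)).sub ((hA t).mul (hs t))).congr_deriv (by ring)
  have e1 := is_const_of_deriv_eq_zero (fun t => (h1 t).differentiableAt)
    (fun t => (h1 t).deriv) t 0
  have e2 := is_const_of_deriv_eq_zero (fun t => (h2 t).differentiableAt)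
    (fun t => (h2 t).deriv) t 0
  have hx0 : x 0 = 1 + a := (isDelaunayProfile ha).x_zero
  have hdx0 : deriv x 0 = 0 := (isDelaunayProfile ha).deriv_x_zero
  have hψ0 : ψ 0 = 0 := delaunayAngle_zero
  have hR : (1 + a) ^ 2 - g - 1 / 2 = (1 + 2 * a) / 2 := by
    simp only [g, delaunayGamma]; ring
  simp only [hx0, hdx0, hψ0, mul_zero, Real.cos_zero, Real.sin_zero, mul_one, add_zero,
    sub_zero, hR] at e1 e2
  have hsc := Real.sin_sq_add_cos_sq (2 * ψ t)
  constructor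
  · linear_combination Real.cos (2 * ψ t) * e1 - Real.sin (2 * ψ t) * e2 - deriv x t * hsc
  · linear_combination Real.sin (2 * ψ t) * e1 + Real.cos (2 * ψ t) * e2 -
      (x t ^ 2 - g - 1 / 2) * hsc

theorem one_add_two_mul_delaunayGamma_pos : 0 < 1 + 2 * delaunayGamma a := by
  have : 1 + 2 * delaunayGamma a = (1 + a) ^ 2 + a ^ 2 := by simp only [delaunayGamma]; ring
  nlinarith [sq_nonneg (1 + 2 * a)]

/-- The conservation law bounds `x²` below by `γ² / (1 + 2 γ)`. -/
theorem exists_le_delaunayX (ha : a ∈ delaunayParams) : ∃ m > 0, ∀ t, m ≤ delaunayX a t := by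
  have hp := one_add_two_mul_delaunayGamma_pos (a := a)
  have hg := delaunayGamma_ne_zero ha
  refine ⟨Real.sqrt (delaunayGamma a ^ 2 / (1 + 2 * delaunayGamma a)),
    Real.sqrt_pos.2 (by positivity), fun t => ?_⟩
  rw [Real.sqrt_le_left (delaunayX_pos ha t).le, div_le_iff₀ hp]
  have h := deriv_delaunayX_sq ha t
  nlinarith [sq_nonneg (deriv (delaunayX a) t), sq_nonneg (delaunayX a t ^ 2)]

/-- A first time at which the amplitude equals `π / 2`. -/
theorem exists_delaunayAngle_eq (ha : a ∈ delaunayParams) :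
    ∃ τ > 0, delaunayAngle a τ = Real.pi / 2 := by
  obtain ⟨m, hm, hmx⟩ := exists_le_delaunayX ha
  have hmono : Monotone fun t => delaunayAngle a t - m * t := by
    have hd : ∀ t, HasDerivAt (fun t => delaunayAngle a t - m * t) (delaunayX a t - m * 1) t :=
      fun t => (hasDerivAt_delaunayAngle ha t).sub ((hasDerivAt_id t).const_mul m)
    refine monotone_of_deriv_nonneg (fun t => (hd t).differentiableAt) fun t => ?_
    rw [(hd t).deriv]
    linarith [hmx t]
  have hT : (0 : ℝ) ≤ Real.pi / 2 / m := by positivity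
  have h1 : Real.pi / 2 ≤ delaunayAngle a (Real.pi / 2 / m) := by
    have := hmono hT
    simp only [delaunayAngle_zero, mul_zero, sub_zero] at this
    rw [mul_div_cancel₀ _ hm.ne'] at this
    linarith
  have hc : Continuous (delaunayAngle a) :=
    continuous_iff_continuousAt.2 fun t => (hasDerivAt_delaunayAngle ha t).continuousAt
  obtain ⟨τ, hτ, hτe⟩ := intermediate_value_Icc hT hc.continuousOn
    (show Real.pi / 2 ∈ Icc _ _ from ⟨by rw [delaunayAngle_zero]; positivity, h1⟩)
  refine ⟨τ, lt_of_le_of_ne hτ.1 ?_, hτe⟩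
  rintro rfl
  rw [delaunayAngle_zero] at hτe
  linarith [Real.pi_pos]

theorem deriv_delaunayX_eq_zero_of_angle (ha : a ∈ delaunayParams) {τ : ℝ}
    (hτ : delaunayAngle a τ = Real.pi / 2) : deriv (delaunayX a) τ = 0 := by
  rw [(delaunay_amplitude ha τ).1, hτ, mul_div_cancel₀ _ two_ne_zero, Real.sin_pi, mul_zero]

/-- Reflection about the time `τ` at which the amplitude is `π / 2`, where `x' = 0`. -/
theorem delaunayX_reflect (ha : a ∈ delaunayParams) {τ : ℝ}
    (hτ : delaunayAngle a τ = Real.pi / 2) (t : ℝ) :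
    delaunayX a (2 * τ - t) = delaunayX a t := by
  have h0 := deriv_delaunayX_eq_zero_of_angle ha hτ
  have e : 2 * τ - τ = τ := by ring
  refine congrFun (duffing_unique (c := 1 + 2 * delaunayGamma a)
    (y := fun t => delaunayX a (2 * τ - t)) (dy := fun t => -deriv (delaunayX a) (2 * τ - t))
    (fun t => (hasDerivAt_delaunayX ha (2 * τ - t)).comp_const_sub _ t)
    (fun t => ((hasDerivAt_deriv_delaunayX ha (2 * τ - t)).comp_const_sub _ t).neg.congr_deriv
      (neg_neg _))
    (hasDerivAt_delaunayX ha) (hasDerivAt_deriv_delaunayX ha) τ (by simp [e]) (by simp [e, h0])) t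

/-- The least positive period of `x_a` is twice the time at which the amplitude reaches `π / 2`: the
reflections about `0` and `τ` give the period `2 τ`, and `x_a` takes the value `x_a(0)` only at
amplitudes in `π ℤ`. -/
theorem delaunayTau_eq (ha : a ∈ delaunayParams) (h2 : a ≠ -1 / 2) {τ : ℝ} (hτ0 : 0 < τ)
    (hτ : delaunayAngle a τ = Real.pi / 2) : delaunayTau a = τ := by
  have hmem : 2 * τ ∈ {P : ℝ | 0 < P ∧ Function.Periodic (delaunayX a) P} := by
    refine ⟨by positivity, fun t => ?_⟩
    have h := delaunayX_reflect ha hτ (-t)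
    rw [delaunayX_even ha] at h
    rw [← h]
    ring_nf
  have hne : (1 + 2 * a) / 2 ≠ 0 := by
    intro h; apply h2; linarith
  have hmono := delaunayAngle_strictMono ha
  have key : ∀ s ∈ Ioc 0 τ, delaunayX a s ≠ delaunayX a 0 := by
    intro s hs h
    have e1 := (delaunay_amplitude ha s).2
    have e2 := (delaunay_amplitude ha 0).2
    rw [h, e2, delaunayAngle_zero, mul_zero, Real.cos_zero] at e1
    have hcos : Real.cos (2 * delaunayAngle a s) = 1 :=
      mul_left_cancel₀ hne (add_left_cancel e1.symm)
    have l1 := hmono hs.1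
    have l2 := hmono.monotone hs.2
    rw [delaunayAngle_zero] at l1
    rw [hτ] at l2
    rw [Real.cos_eq_one_iff_of_lt_of_lt (by linarith [Real.pi_pos])
      (by linarith [Real.pi_pos])] at hcos
    linarith
  have hl : IsLeast {P : ℝ | 0 < P ∧ Function.Periodic (delaunayX a) P} (2 * τ) := by
    refine ⟨hmem, fun P hP => ?_⟩
    by_contra hlt
    push Not at hlt
    have hx : delaunayX a P = delaunayX a 0 := by simpa using hP.2 0
    rcases le_or_gt P τ with h | h
    · exact key P ⟨hP.1, h⟩ hx
    · exact key (2 * τ - P) ⟨by linarith, by linarith⟩ ((delaunayX_reflect ha hτ P).trans hx)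
  rw [delaunayTau, hl.csInf_eq]
  ring

theorem delaunayTau_pos_and_angle (ha : a ∈ delaunayParams) (h2 : a ≠ -1 / 2) :
    0 < delaunayTau a ∧ delaunayAngle a (delaunayTau a) = Real.pi / 2 := by
  obtain ⟨τ, h0, h⟩ := exists_delaunayAngle_eq ha
  rw [delaunayTau_eq ha h2 h0 h]
  exact ⟨h0, h⟩

/-- A half period maps the radius to its inverse, up to the factor `|γ|`. -/
theorem delaunayX_add_tau (ha : a ∈ delaunayParams) (h2 : a ≠ -1 / 2) (t : ℝ) :
    delaunayX a (t + delaunayTau a) = |delaunayGamma a| / delaunayX a t := by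
  have hτ := (delaunayTau_pos_and_angle ha h2).2
  set τ := delaunayTau a
  have hxτ : delaunayX a τ = |a| := by
    have h := (delaunay_amplitude ha τ).2
    rw [hτ, mul_div_cancel₀ _ two_ne_zero, Real.cos_pi] at h
    rw [← abs_of_pos (delaunayX_pos ha τ), ← sq_eq_sq_iff_abs_eq_abs, h, delaunayGamma]
    ring
  have hx0 : delaunayX a 0 = 1 + a := (isDelaunayProfile ha).x_zero
  have hdx0 : deriv (delaunayX a) 0 = 0 := (isDelaunayProfile ha).deriv_x_zero
  refine congrFun (duffing_unique (c := 1 + 2 * delaunayGamma a)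
    (y := fun t => delaunayX a (t + τ)) (dy := fun t => deriv (delaunayX a) (t + τ))
    (z := fun t => |delaunayGamma a| / delaunayX a t)
    (dz := fun t => -(|delaunayGamma a| * deriv (delaunayX a) t) / delaunayX a t ^ 2)
    (fun t => (hasDerivAt_delaunayX ha (t + τ)).comp_add_const t τ)
    (fun t => (hasDerivAt_deriv_delaunayX ha (t + τ)).comp_add_const t τ)
    (fun t => ?_) (fun t => ?_) 0 ?_ ?_) t
  · refine ((hasDerivAt_const t |delaunayGamma a|).div (hasDerivAt_delaunayX ha t)
      (delaunayX_pos ha t).ne').congr_deriv (by ring)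
  · have hx := (delaunayX_pos ha t).ne'
    refine (((hasDerivAt_deriv_delaunayX ha t).const_mul _).neg.div
      ((hasDerivAt_delaunayX ha t).pow 2) (pow_ne_zero 2 hx)).congr_deriv ?_
    have h := deriv_delaunayX_sq ha t
    have hg := sq_abs (delaunayGamma a)
    simp only [Pi.neg_apply, Pi.pow_apply, Nat.cast_ofNat, Nat.add_one_sub_one, pow_one]
    field_simp
    linear_combination 2 * |delaunayGamma a| * h + 2 * |delaunayGamma a| * hg
  · simp only [zero_add, hxτ, hx0, delaunayGamma, abs_mul, abs_of_pos (one_add_pos_of_mem ha)]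
    rw [mul_div_assoc, div_self (one_add_pos_of_mem ha).ne', mul_one]
  · simp [hdx0, deriv_delaunayX_eq_zero_of_angle ha hτ]

theorem mul_deriv_delaunayX_neg (ha : a ∈ delaunayParams) (h2 : a ≠ -1 / 2) {t : ℝ}
    (ht : t ∈ Ioo 0 (delaunayTau a)) : (1 + 2 * a) * deriv (delaunayX a) t < 0 := by
  have hτ := (delaunayTau_pos_and_angle ha h2).2
  have hmono := delaunayAngle_strictMono ha
  have l1 := hmono ht.1
  have l2 := hmono ht.2
  rw [delaunayAngle_zero] at l1
  rw [hτ] at l2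
  have hs : 0 < Real.sin (2 * delaunayAngle a t) :=
    Real.sin_pos_of_pos_of_lt_pi (by linarith) (by linarith)
  have hne : 1 + 2 * a ≠ 0 := by intro h; apply h2; linarith
  rw [(delaunay_amplitude ha t).1]
  have : 0 < (1 + 2 * a) ^ 2 := by positivity
  nlinarith [mul_pos this hs]

/-- The potential `p = 2 (x² + γ² / x²)` of the Jacobi equation `φ_tt + φ_θθ + p φ = 0`; it is the
squared norm of the second fundamental form times the conformal factor `x²`. -/
noncomputable def jacobiPotential (a : ℝ) (t : ℝ) : ℝ :=
  2 * (delaunayX a t ^ 2 + delaunayGamma a ^ 2 / delaunayX a t ^ 2)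

theorem continuous_jacobiPotential (ha : a ∈ delaunayParams) :
    Continuous (jacobiPotential a) := by
  have h := continuous_delaunayX ha
  refine continuous_const.mul ((h.pow 2).add (continuous_const.div (h.pow 2) fun t => ?_))
  exact pow_ne_zero 2 (delaunayX_pos ha t).ne'

theorem jacobiPotential_even (ha : a ∈ delaunayParams) : Function.Even (jacobiPotential a) :=
  fun t => by simp only [jacobiPotential, delaunayX_even ha t]

theorem jacobiPotential_add_tau (ha : a ∈ delaunayParams) (h2 : a ≠ -1 / 2) (t : ℝ) :
    jacobiPotential a (t + delaunayTau a) = jacobiPotential a t := by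
  have hx := (delaunayX_pos ha t).ne'
  have hg := delaunayGamma_ne_zero ha
  simp only [jacobiPotential, delaunayX_add_tau ha h2, div_pow, sq_abs]
  field_simp
  ring

theorem four_mul_le_jacobiPotential (ha : a ∈ delaunayParams) (t : ℝ) :
    4 * delaunayGamma a ≤ jacobiPotential a t := by
  have hx := (delaunayX_pos ha t).ne'
  have : jacobiPotential a t - 4 * delaunayGamma a =
      2 * (delaunayX a t - delaunayGamma a / delaunayX a t) ^ 2 := by
    simp only [jacobiPotential]
    field_simp
    ring
  nlinarith [sq_nonneg (delaunayX a t - delaunayGamma a / delaunayX a t)]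

theorem jacobiPotential_le (ha : a ∈ delaunayParams) (t : ℝ) :
    jacobiPotential a t ≤ 2 + 4 * delaunayGamma a := by
  have hx := (delaunayX_pos ha t).ne'
  have h := deriv_delaunayX_sq ha t
  have : jacobiPotential a t = 2 + 4 * delaunayGamma a -
      2 * (deriv (delaunayX a) t / delaunayX a t) ^ 2 := by
    rw [div_pow, h]
    simp only [jacobiPotential]
    field_simp
    ring
  nlinarith [sq_nonneg (deriv (delaunayX a) t / delaunayX a t)]

theorem jacobiPotential_nonneg (a t : ℝ) : 0 ≤ jacobiPotential a t := by
  unfold jacobiPotential; positivity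

/-- The logarithmic derivative of the radius, which is (up to sign) the normal component of the
vertical translations. -/
theorem solvesOn_logDeriv (ha : a ∈ delaunayParams) :
    SolvesOn (fun t => -jacobiPotential a t) (fun t => deriv (delaunayX a) t / delaunayX a t)
      (fun t => delaunayGamma a ^ 2 / delaunayX a t ^ 2 - delaunayX a t ^ 2) univ := by
  intro t _
  have hx := (delaunayX_pos ha t).ne'
  have h1 := hasDerivAt_delaunayX ha t
  have h := deriv_delaunayX_sq ha t
  constructor
  · refine ((hasDerivAt_deriv_delaunayX ha t).div h1 hx).congr_deriv ?_
    field_simp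
    linear_combination -h
  · refine (((hasDerivAt_const t (delaunayGamma a ^ 2)).div (h1.pow 2) (pow_ne_zero 2 hx)).sub
      (h1.pow 2)).congr_deriv ?_
    simp only [jacobiPotential, Pi.pow_apply, Nat.cast_ofNat, Nat.add_one_sub_one, pow_one]
    field_simp
    ring

/-- For `c = γ` this is the profile of the horizontal translations; for `c = |γ|` it is the
difference between the radius and its shift by a half period. -/
theorem solvesOn_sub_div (ha : a ∈ delaunayParams) {c : ℝ} (hc : c ^ 2 = delaunayGamma a ^ 2) :
    SolvesOn (fun t => 1 + 2 * delaunayGamma a - 2 * c - jacobiPotential a t)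
      (fun t => delaunayX a t - c / delaunayX a t)
      (fun t => deriv (delaunayX a) t * (1 + c / delaunayX a t ^ 2)) univ := by
  intro t _
  have hx := (delaunayX_pos ha t).ne'
  have h1 := hasDerivAt_delaunayX ha t
  have h := deriv_delaunayX_sq ha t
  constructor
  · refine (h1.sub ((hasDerivAt_const t c).div h1 hx)).congr_deriv ?_
    field_simp
    ring
  · refine ((hasDerivAt_deriv_delaunayX ha t).mul
      (((hasDerivAt_const t c).div (h1.pow 2) (pow_ne_zero 2 hx)).const_add 1)).congr_deriv ?_
    simp only [jacobiPotential, Pi.pow_apply, Pi.div_apply, Nat.cast_ofNat, Nat.add_one_sub_one,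
      pow_one]
    field_simp
    rw [← hc]
    rw [← sub_eq_zero]
    have hc' : delaunayGamma a ^ 2 = c ^ 2 := hc.symm
    linear_combination (-2 * c) * h + (2 * c) * hc'

end Profile

/-! ### Comparison theorems -/

theorem pos_of_no_zero {w : ℝ → ℝ} (hw : Continuous w) {b : ℝ} (h0 : 0 < w 0)
    (hz : ∀ t ∈ Ioo 0 b, w t ≠ 0) {t : ℝ} (ht : t ∈ Ico 0 b) : 0 < w t := by
  by_contra hcon
  obtain ⟨s, hs, hs0⟩ := intermediate_value_Icc' ht.1 hw.continuousOn
    (show (0 : ℝ) ∈ Icc _ _ from ⟨not_lt.1 hcon, h0.le⟩)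
  rcases hs.1.eq_or_lt with h | h
  · rw [← h] at hs0
    exact h0.ne' hs0
  · exact hz s ⟨h, hs.2.trans_lt ht.2⟩ hs0

/-- If `w'' = q w` oscillates slower than the positive solution `v` of `v'' = r v`, then `w` has no
zero: up to a first zero, the quotient `w / v` would be nondecreasing. -/
theorem SolvesOn.ne_zero_of_comparison {q r w dw v dv : ℝ → ℝ} (hw : SolvesOn q w dw univ)
    (hv : SolvesOn r v dv univ) (hqr : ∀ t, r t ≤ q t) (hpos : ∀ t, 0 < v t) (hw0 : 0 < w 0)
    (hdw : dw 0 = 0) (hdv : dv 0 = 0) {T : ℝ} (hT : 0 < T) : w T ≠ 0 := by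
  intro hTz
  have hcl : IsCompact (Icc 0 T ∩ w ⁻¹' {0}) :=
    isCompact_Icc.inter_right (isClosed_singleton.preimage hw.continuous)
  obtain ⟨s, hs, hmin⟩ := hcl.exists_isLeast ⟨T, ⟨hT.le, le_rfl⟩, hTz⟩
  have hs0 : w s = 0 := hs.2
  have hwpos : ∀ t ∈ Ico 0 s, 0 < w t := fun t ht =>
    pos_of_no_zero hw.continuous hw0
      (fun t ht h => absurd (hmin ⟨⟨ht.1.le, ht.2.le.trans hs.1.2⟩, h⟩) (not_le.2 ht.2)) ht
  have hW : MonotoneOn (fun t => dw t * v t - w t * dv t) (Icc 0 s) := by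
    have hd := fun t => hw.hasDerivAt_wronskian hv (mem_univ t)
    refine monotoneOn_of_deriv_nonneg (convex_Icc 0 s)
      (fun t _ => (hd t).continuousAt.continuousWithinAt)
      (fun t _ => (hd t).differentiableAt.differentiableWithinAt) fun t ht => ?_
    rw [interior_Icc] at ht
    rw [(hd t).deriv]
    exact mul_nonneg (sub_nonneg.2 (hqr t)) (mul_pos (hwpos t (Ioo_subset_Ico_self ht)) (hpos t)).le
  have hR : MonotoneOn (fun t => w t / v t) (Icc 0 s) := by
    have hd := fun t => (hw t trivial).1.div (hv t trivial).1 (hpos t).ne'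
    refine monotoneOn_of_deriv_nonneg (convex_Icc 0 s)
      (fun t _ => (hd t).continuousAt.continuousWithinAt)
      (fun t _ => (hd t).differentiableAt.differentiableWithinAt) fun t ht => ?_
    rw [interior_Icc] at ht
    have h := hW (left_mem_Icc.2 hs.1.1) (Ioo_subset_Icc_self ht) ht.1.le
    simp only [hdw, hdv, zero_mul, mul_zero, sub_zero] at h
    have he : deriv (fun t => w t / v t) t = (dw t * v t - w t * dv t) / v t ^ 2 := (hd t).deriv
    rw [he]
    positivity
  have h := hR (left_mem_Icc.2 hs.1.1) (right_mem_Icc.2 hs.1.1) hs.1.1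
  simp only [hs0, zero_div] at h
  exact absurd h (not_le.2 (div_pos hw0 (hpos 0)))

/-- Sturm comparison: if `w'' = q w` oscillates faster than `v'' = r v`, then `w` vanishes before
the first zero `b` of `v`. -/
theorem SolvesOn.exists_zero_of_comparison {q r w dw v dv : ℝ → ℝ} (hw : SolvesOn q w dw univ)
    (hv : SolvesOn r v dv univ) {b : ℝ} (hb : 0 < b) (hqr : ∀ t, q t < r t)
    (hpos : ∀ t ∈ Ioo 0 b, 0 < v t) (hvb : v b = 0) (hdvb : dv b ≤ 0) (hw0 : 0 < w 0)
    (hdw : dw 0 = 0) (hdv : dv 0 = 0) : ∃ s ∈ Ioo 0 b, w s = 0 := by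
  by_contra! hz
  have hwpos : ∀ t ∈ Ico 0 b, 0 < w t := fun t ht => pos_of_no_zero hw.continuous hw0 hz ht
  have hwb : 0 ≤ w b := by
    have h1 : Tendsto w (𝓝[<] b) (𝓝 (w b)) := hw.continuous.continuousAt.mono_left nhdsWithin_le_nhds
    refine ge_of_tendsto h1 ?_
    filter_upwards [Ioo_mem_nhdsLT hb] with t ht
    exact (hwpos t (Ioo_subset_Ico_self ht)).le
  have hW : StrictAntiOn (fun t => dw t * v t - w t * dv t) (Icc 0 b) := by
    have hd := fun t => hw.hasDerivAt_wronskian hv (mem_univ t)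
    refine strictAntiOn_of_deriv_neg (convex_Icc 0 b)
      (fun t _ => (hd t).continuousAt.continuousWithinAt) fun t ht => ?_
    rw [interior_Icc] at ht
    rw [(hd t).deriv]
    exact mul_neg_of_neg_of_pos (sub_neg.2 (hqr t))
      (mul_pos (hwpos t (Ioo_subset_Ico_self ht)) (hpos t ht))
  have h := hW (left_mem_Icc.2 hb.le) (right_mem_Icc.2 hb.le) hb
  simp only [hdw, hdv, hvb, zero_mul, mul_zero, sub_zero, zero_sub] at h
  nlinarith

/-! ### Zeros of the even solutions of the mode equations -/

section Modes

variable {a : ℝ}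

/-- `w` is the even solution of the `j`-th mode equation `w'' = (j² - p) w`, with `w(0) = 1`. -/
structure IsMode (a : ℝ) (j : ℕ) (w dw : ℝ → ℝ) : Prop where
  solves : SolvesOn (fun t => (j : ℝ) ^ 2 - jacobiPotential a t) w dw univ
  zero : w 0 = 1
  deriv_zero : dw 0 = 0

theorem continuous_modePotential (ha : a ∈ delaunayParams) (j : ℕ) :
    Continuous fun t => (j : ℝ) ^ 2 - jacobiPotential a t :=
  continuous_const.sub (continuous_jacobiPotential ha)

theorem abs_modePotential_le (ha : a ∈ delaunayParams) (j : ℕ) (t : ℝ) :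
    |(j : ℝ) ^ 2 - jacobiPotential a t| ≤ (j : ℝ) ^ 2 + (2 + 4 * delaunayGamma a) := by
  have h1 := jacobiPotential_le ha t
  have h2 := jacobiPotential_nonneg a t
  have h3 : (0 : ℝ) ≤ (j : ℝ) ^ 2 := by positivity
  rw [abs_le]
  constructor <;> linarith

theorem exists_isMode (ha : a ∈ delaunayParams) (j : ℕ) : ∃ w dw, IsMode a j w dw := by
  obtain ⟨w, dw, h, h0, h1⟩ :=
    exists_solvesOn (continuous_modePotential ha j) (abs_modePotential_le ha j)
  exact ⟨w, dw, h, h0, h1⟩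

theorem IsMode.even (ha : a ∈ delaunayParams) {j : ℕ} {w dw : ℝ → ℝ} (h : IsMode a j w dw) :
    Function.Even w :=
  h.solves.even (continuous_modePotential ha j)
    (fun t => by simp only [jacobiPotential_even ha t]) h.deriv_zero

theorem deriv_delaunayX_zero (ha : a ∈ delaunayParams) : deriv (delaunayX a) 0 = 0 :=
  (isDelaunayProfile ha).deriv_x_zero

theorem delaunayX_zero (ha : a ∈ delaunayParams) : delaunayX a 0 = 1 + a :=
  (isDelaunayProfile ha).x_zero

theorem deriv_delaunayX_neg (ha : a ∈ delaunayParams) (t : ℝ) :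
    deriv (delaunayX a) (-t) = -deriv (delaunayX a) t := by
  have h := (hasDerivAt_delaunayX ha (0 - t)).comp_const_sub 0 t
  have he : (fun t => delaunayX a (0 - t)) = delaunayX a := by
    funext s; rw [zero_sub, delaunayX_even ha]
  rw [he, zero_sub] at h
  have := h.unique (hasDerivAt_delaunayX ha t)
  linarith

theorem deriv_delaunayX_add_tau (ha : a ∈ delaunayParams) (h2 : a ≠ -1 / 2) (t : ℝ) :
    deriv (delaunayX a) (t + delaunayTau a) =
      -(|delaunayGamma a| * deriv (delaunayX a) t) / delaunayX a t ^ 2 := by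
  have h := (hasDerivAt_delaunayX ha (t + delaunayTau a)).comp_add_const t (delaunayTau a)
  simp only [delaunayX_add_tau ha h2] at h
  refine h.unique (((hasDerivAt_const t |delaunayGamma a|).div (hasDerivAt_delaunayX ha t)
      (delaunayX_pos ha t).ne').congr_deriv (by ring))

/-- The logarithmic derivative `u = x' / x` changes sign under a shift by a half period. -/
theorem logDeriv_add_tau (ha : a ∈ delaunayParams) (h2 : a ≠ -1 / 2) (t : ℝ) :
    deriv (delaunayX a) (t + delaunayTau a) / delaunayX a (t + delaunayTau a) =
      -(deriv (delaunayX a) t / delaunayX a t) := by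
  have hx := (delaunayX_pos ha t).ne'
  have hg : |delaunayGamma a| ≠ 0 := abs_ne_zero.2 (delaunayGamma_ne_zero ha)
  rw [deriv_delaunayX_add_tau ha h2, delaunayX_add_tau ha h2]
  field_simp

/-- `x - |γ| / x`, which is the radius minus its shift by a half period, is antiperiodic. -/
theorem sub_div_add_tau (ha : a ∈ delaunayParams) (h2 : a ≠ -1 / 2) (t : ℝ) :
    delaunayX a (t + delaunayTau a) - |delaunayGamma a| / delaunayX a (t + delaunayTau a) =
      -(delaunayX a t - |delaunayGamma a| / delaunayX a t) := by
  have hx := (delaunayX_pos ha t).ne'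
  have hg : |delaunayGamma a| ≠ 0 := abs_ne_zero.2 (delaunayGamma_ne_zero ha)
  rw [delaunayX_add_tau ha h2]
  field_simp
  ring

theorem sub_div_half_tau (ha : a ∈ delaunayParams) (h2 : a ≠ -1 / 2) :
    delaunayX a (delaunayTau a / 2) - |delaunayGamma a| / delaunayX a (delaunayTau a / 2) = 0 := by
  rw [← delaunayX_add_tau ha h2, sub_eq_zero]
  have h := delaunayX_reflect ha (delaunayTau_pos_and_angle ha h2).2 (delaunayTau a / 2)
  rw [← h]
  ring_nf

theorem sub_div_strictAntiOn (ha : a ∈ delaunayParams) (h2 : a ≠ -1 / 2) :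
    StrictAntiOn (fun t => (1 + 2 * a) * (delaunayX a t - |delaunayGamma a| / delaunayX a t))
      (Icc 0 (delaunayTau a)) := by
  have hd := fun t => ((solvesOn_sub_div ha (sq_abs (delaunayGamma a)) t trivial).1).const_mul
    (1 + 2 * a)
  refine strictAntiOn_of_deriv_neg (convex_Icc _ _)
    (fun t _ => (hd t).continuousAt.continuousWithinAt) fun t ht => ?_
  rw [interior_Icc] at ht
  rw [(hd t).deriv, ← mul_assoc]
  refine mul_neg_of_neg_of_pos (mul_deriv_delaunayX_neg ha h2 ht) ?_
  have := delaunayX_pos ha t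
  positivity

theorem exists_nat_add_tau {τ T : ℝ} (hτ : 0 < τ) (hT : 0 < T) :
    ∃ (k : ℕ) (t : ℝ), t ∈ Ico 0 τ ∧ T = t + k * τ := by
  refine ⟨⌊T / τ⌋₊, T - ⌊T / τ⌋₊ * τ, ⟨?_, ?_⟩, by ring⟩
  · have := Nat.floor_le (div_pos hT hτ).le
    rw [le_div_iff₀ hτ] at this
    linarith
  · have := Nat.lt_floor_add_one (T / τ)
    rw [div_lt_iff₀ hτ] at this
    linarith

/-- Before the time `τ / 2`, the rotationally symmetric mode has a zero: it oscillates faster than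
`x - |γ| / x`, whose first zero is `τ / 2`. -/
theorem IsMode.exists_zero (ha : a ∈ delaunayParams) (h2 : a ≠ -1 / 2) {w dw : ℝ → ℝ}
    (h : IsMode a 0 w dw) : ∃ s ∈ Ioo 0 (delaunayTau a / 2), w s = 0 := by
  have hτ := (delaunayTau_pos_and_angle ha h2).1
  have hanti := sub_div_strictAntiOn ha h2
  have hhalf := sub_div_half_tau ha h2
  have hmem : delaunayTau a / 2 ∈ Icc 0 (delaunayTau a) := ⟨by linarith, by linarith⟩
  refine h.solves.exists_zero_of_comparison
    ((solvesOn_sub_div ha (sq_abs (delaunayGamma a))).const_mul (1 + 2 * a)) (half_pos hτ) ?_ ?_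
    (by rw [hhalf, mul_zero]) ?_ (by rw [h.zero]; exact one_pos) h.deriv_zero
    (by simp [deriv_delaunayX_zero ha])
  · intro t
    have : 0 < 1 + 2 * delaunayGamma a - 2 * |delaunayGamma a| := by
      rcases abs_cases (delaunayGamma a) with ⟨h, -⟩ | ⟨h, -⟩
      · rw [h]; linarith
      · have hne : 1 + 2 * a ≠ 0 := by intro h; apply h2; linarith
        have h3 : 1 + 2 * delaunayGamma a - 2 * -delaunayGamma a = (1 + 2 * a) ^ 2 := by
          simp only [delaunayGamma]; ring
        rw [h, h3]
        positivity
    push_cast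
    linarith
  · intro t ht
    have h3 := hanti ⟨ht.1.le, by linarith [ht.2]⟩ hmem ht.2
    simp only [hhalf, mul_zero] at h3
    exact h3
  · rw [← mul_assoc]
    refine mul_nonpos_of_nonpos_of_nonneg
      (mul_deriv_delaunayX_neg ha h2 ⟨half_pos hτ, half_lt_self hτ⟩).le ?_
    have := delaunayX_pos ha (delaunayTau a / 2)
    positivity

theorem IsMode.solves_zero {w dw : ℝ → ℝ} (h : IsMode a 0 w dw) :
    SolvesOn (fun t => -jacobiPotential a t) w dw univ := by
  have := h.solves
  simpa using this

/-- Under a shift by a half period, the even solution `w` changes by its sign and a multiple of the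
odd solution `u = x' / x`. -/
theorem IsMode.exists_add_tau (ha : a ∈ delaunayParams) (h2 : a ≠ -1 / 2) {w dw : ℝ → ℝ}
    (h : IsMode a 0 w dw) : ∃ B, ∀ t, w (t + delaunayTau a) =
      -w t + B * (deriv (delaunayX a) t / delaunayX a t) := by
  have hne : 1 + 2 * a ≠ 0 := by intro h; apply h2; linarith
  have hu := solvesOn_logDeriv ha
  have ha1 := (one_add_pos_of_mem ha).ne'
  have hdu0 : delaunayGamma a ^ 2 / delaunayX a 0 ^ 2 - delaunayX a 0 ^ 2 = -(1 + 2 * a) := by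
    rw [delaunayX_zero ha, delaunayGamma]
    field_simp
    ring
  have hduτ : delaunayGamma a ^ 2 / delaunayX a (delaunayTau a) ^ 2 -
      delaunayX a (delaunayTau a) ^ 2 = 1 + 2 * a := by
    have hx := delaunayX_add_tau ha h2 0
    rw [zero_add] at hx
    rw [hx, delaunayX_zero ha, div_pow, sq_abs, delaunayGamma]
    have := ne_zero_of_mem ha
    field_simp
    ring
  have huτ : deriv (delaunayX a) (delaunayTau a) / delaunayX a (delaunayTau a) = 0 := by
    have := logDeriv_add_tau ha h2 0
    rw [zero_add, deriv_delaunayX_zero ha] at this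
    simpa using this
  have hwτ : w (delaunayTau a) = -1 := by
    have hW := h.solves_zero.wronskian_eq hu (delaunayTau a) 0
    simp only [hduτ, huτ, hdu0, h.zero, h.deriv_zero] at hW
    exact mul_right_cancel₀ hne (by linarith)
  have hv := (h.solves_zero.comp_add_const (delaunayTau a))
  simp only [jacobiPotential_add_tau ha h2] at hv
  refine ⟨-(dw (delaunayTau a) / (1 + 2 * a)), fun t => ?_⟩
  have := congrFun (SolvesOn.eq (continuous_jacobiPotential ha).neg (hv.add h.solves_zero)
    (hu.const_mul (-(dw (delaunayTau a) / (1 + 2 * a)))) 0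
    (by simp [hwτ, h.zero, deriv_delaunayX_zero ha])
    (by rw [hdu0, zero_add, h.deriv_zero]; field_simp; ring)).1 t
  linarith

/-- The rotationally symmetric mode has exactly one zero in each interval `(k τ, (k + 1) τ)`, and it
lies in the first half of the interval. -/
theorem zeros_isMode_zero (ha : a ∈ delaunayParams) (h2 : a ≠ -1 / 2) {w dw : ℝ → ℝ}
    (h : IsMode a 0 w dw) : ∃ T : ℕ → ℝ,
      (∀ k : ℕ, T k ∈ Ioo (k * delaunayTau a) ((k + 1 / 2) * delaunayTau a)) ∧
      {t | 0 < t ∧ w t = 0} = range T := by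
  have hne : 1 + 2 * a ≠ 0 := by intro h; apply h2; linarith
  have hτ := (delaunayTau_pos_and_angle ha h2).1
  have hu := solvesOn_logDeriv ha
  have ha1 := (one_add_pos_of_mem ha).ne'
  obtain ⟨B, hB⟩ := h.exists_add_tau ha h2
  obtain ⟨s, hs, hs0⟩ := h.exists_zero ha h2
  have huadd := logDeriv_add_tau ha h2
  set τ := delaunayTau a
  set u : ℝ → ℝ := fun t => deriv (delaunayX a) t / delaunayX a t with hudef
  have huadd : ∀ t, u (t + τ) = -u t := huadd
  have hB : ∀ t, w (t + τ) = -w t + B * u t := hB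
  have hu0 : u 0 = 0 := by simp [hudef, deriv_delaunayX_zero ha]
  have huneg : ∀ t, u (-t) = -u t := fun t => by
    simp only [hudef, deriv_delaunayX_neg ha, delaunayX_even ha t, neg_div]
  have hshift : ∀ (k : ℕ) (t : ℝ),
      u (t + k * τ) = (-1) ^ k * u t ∧ w (t + k * τ) = (-1) ^ k * (w t - k * B * u t) := by
    intro k t
    induction k with
    | zero => simp
    | succ k ih =>
      have e : t + ((k + 1 : ℕ) : ℝ) * τ = t + k * τ + τ := by push_cast; ring
      rw [e, huadd, hB, ih.1, ih.2]
      push_cast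
      constructor <;> ring
  -- evaluate the shift relation at `-τ / 2`, where `w` is even and `u` is odd
  have hhalf : 2 * w (τ / 2) = -(B * u (τ / 2)) := by
    have e := hB (-(τ / 2))
    rw [h.even ha, huneg, show -(τ / 2) + τ = τ / 2 by ring] at e
    linarith
  have husign : ∀ t ∈ Ioo 0 τ, (1 + 2 * a) * u t < 0 := fun t ht => by
    rw [hudef, ← mul_div_assoc]
    exact div_neg_of_neg_of_pos (mul_deriv_delaunayX_neg ha h2 ht) (delaunayX_pos ha t)
  have hune : ∀ t ∈ Ioo 0 τ, u t ≠ 0 := fun t ht h0 => by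
    have := husign t ht
    rw [h0, mul_zero] at this
    exact lt_irrefl _ this
  -- the Wronskian of `w` and `u` is `1 + 2 a`, so `w / ((1 + 2 a) u)` has derivative `1 / u²`
  have hmono : StrictMonoOn (fun t => w t / ((1 + 2 * a) * u t)) (Ioo 0 τ) := by
    have hd : ∀ t ∈ Ioo 0 τ, HasDerivAt (fun t => w t / ((1 + 2 * a) * u t)) (1 / u t ^ 2) t := by
      intro t ht
      refine ((h.solves t trivial).1.div ((hu t trivial).1.const_mul (1 + 2 * a))
        (mul_ne_zero hne (hune t ht))).congr_deriv ?_
      have hW := h.solves_zero.wronskian_eq hu t 0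
      have hW0 : dw 0 * (deriv (delaunayX a) 0 / delaunayX a 0) -
          w 0 * (delaunayGamma a ^ 2 / delaunayX a 0 ^ 2 - delaunayX a 0 ^ 2) = 1 + 2 * a := by
        rw [delaunayX_zero ha, h.zero, h.deriv_zero, delaunayGamma]
        field_simp
        ring
      rw [hW0] at hW
      rw [div_eq_div_iff (pow_ne_zero 2 (mul_ne_zero hne (hune t ht))) (pow_ne_zero 2 (hune t ht))]
      have hW : dw t * u t - w t * (delaunayGamma a ^ 2 / delaunayX a t ^ 2 - delaunayX a t ^ 2) =
        1 + 2 * a := hW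
      linear_combination ((1 + 2 * a) * u t ^ 2) * hW
    refine strictMonoOn_of_deriv_pos (convex_Ioo _ _)
      (fun t ht => (hd t ht).continuousAt.continuousWithinAt) fun t ht => ?_
    rw [interior_Ioo] at ht
    rw [(hd t ht).deriv]
    have := hune t ht
    positivity
  have hmem : τ / 2 ∈ Ioo 0 τ := ⟨half_pos hτ, half_lt_self hτ⟩
  have hwhalf : w (τ / 2) < 0 := by
    have h3 := hmono ⟨hs.1, hs.2.trans hmem.2⟩ hmem hs.2
    simp only [hs0, zero_div] at h3
    by_contra hcon
    exact absurd h3 (not_lt.2 (div_nonpos_of_nonneg_of_nonpos (not_lt.1 hcon) (husign _ hmem).le))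
  have huc : Continuous u := hu.continuous
  -- `w - k B u` is `1` at `0` and `(2 k + 1) w(τ / 2) < 0` at `τ / 2`
  have hex : ∀ k : ℕ, ∃ t ∈ Ioo 0 (τ / 2), w t - k * B * u t = 0 := by
    intro k
    have hc : Continuous fun t => w t - k * B * u t := by
      have := h.solves.continuous
      fun_prop
    refine intermediate_value_Ioo' (half_pos hτ).le hc.continuousOn ⟨?_, ?_⟩
    · have : w (τ / 2) - k * B * u (τ / 2) = (2 * k + 1) * w (τ / 2) := by
        linear_combination (-k : ℝ) * hhalf
      rw [this]
      exact mul_neg_of_pos_of_neg (by positivity) hwhalf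
    · simp [hu0, h.zero]
  choose t ht ht0 using hex
  refine ⟨fun k => t k + k * τ, fun k => ⟨by linarith [(ht k).1], by linarith [(ht k).2]⟩, ?_⟩
  ext T
  constructor
  · rintro ⟨hT, hT0⟩
    obtain ⟨k, r, hr, rfl⟩ := exists_nat_add_tau hτ hT
    rw [(hshift k r).2, mul_eq_zero, or_iff_right (pow_ne_zero k (by norm_num))] at hT0
    have hr0 : 0 < r := by
      refine lt_of_le_of_ne hr.1 ?_
      rintro rfl
      simp [hu0, h.zero] at hT0
    have hrm : r ∈ Ioo 0 τ := ⟨hr0, hr.2⟩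
    have htm : t k ∈ Ioo 0 τ := ⟨(ht k).1, (ht k).2.trans hmem.2⟩
    refine ⟨k, ?_⟩
    have : t k = r := by
      refine hmono.injOn htm hrm ?_
      rw [show w (t k) = k * B * u (t k) by linarith [ht0 k],
        show w r = k * B * u r by linarith, mul_div_mul_right _ _ (hune _ htm),
        mul_div_mul_right _ _ (hune _ hrm)]
    simp only [this]
  · rintro ⟨k, rfl⟩
    refine ⟨by have := (ht k).1; positivity, ?_⟩
    rw [(hshift k (t k)).2, ht0 k, mul_zero]

/-- The mode `j = 1` is the normal component of the horizontal translations. -/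
theorem isMode_one (ha : a ∈ delaunayParams) {w dw : ℝ → ℝ} (h : IsMode a 1 w dw) (t : ℝ) :
    w t = delaunayX a t - delaunayGamma a / delaunayX a t := by
  have hs := solvesOn_sub_div ha (c := delaunayGamma a) rfl
  have e : (fun t => 1 + 2 * delaunayGamma a - 2 * delaunayGamma a - jacobiPotential a t) =
      fun t => ((1 : ℕ) : ℝ) ^ 2 - jacobiPotential a t := by
    funext t; push_cast; ring
  rw [e] at hs
  have ha1 := (one_add_pos_of_mem ha).ne'
  refine congrFun (SolvesOn.eq (continuous_modePotential ha 1) h.solves hs 0 ?_ ?_).1 t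
  · simp only [h.zero, delaunayX_zero ha, delaunayGamma]
    field_simp
    ring
  · simp [h.deriv_zero, deriv_delaunayX_zero ha]

theorem zeros_isMode_one (ha : a ∈ delaunayParams) (h0 : 0 < a) {w dw : ℝ → ℝ}
    (h : IsMode a 1 w dw) :
    {t | 0 < t ∧ w t = 0} = range fun k : ℕ => ((k : ℝ) + 1 / 2) * delaunayTau a := by
  have h2 : a ≠ -1 / 2 := by intro h; linarith
  have hτ := (delaunayTau_pos_and_angle ha h2).1
  have hg : |delaunayGamma a| = delaunayGamma a := by
    rw [abs_of_pos]; unfold delaunayGamma; positivity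
  have hadd := sub_div_add_tau ha h2
  have hhalf := sub_div_half_tau ha h2
  have hanti := sub_div_strictAntiOn ha h2
  simp only [hg, ← isMode_one ha h] at hadd hhalf hanti
  set τ := delaunayTau a
  have hshift : ∀ (k : ℕ) (t : ℝ), w (t + k * τ) = (-1) ^ k * w t := by
    intro k t
    induction k with
    | zero => simp
    | succ k ih =>
      have e : t + ((k + 1 : ℕ) : ℝ) * τ = t + k * τ + τ := by push_cast; ring
      rw [e, hadd, ih, pow_succ]
      ring
  ext T
  constructor
  · rintro ⟨hT, hT0⟩
    obtain ⟨k, r, hr, rfl⟩ := exists_nat_add_tau hτ hT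
    rw [hshift, mul_eq_zero, or_iff_right (pow_ne_zero k (by norm_num))] at hT0
    have hr2 : τ / 2 = r := hanti.injOn ⟨by linarith, by linarith⟩ ⟨hr.1, hr.2.le⟩
      (by simp only [hhalf, hT0])
    exact ⟨k, by simp only [← hr2]; ring⟩
  · rintro ⟨k, rfl⟩
    refine ⟨by positivity, ?_⟩
    beta_reduce
    rw [show ((k : ℝ) + 1 / 2) * τ = τ / 2 + k * τ by ring, hshift, hhalf, mul_zero]

/-- For `a < 0` the explicit first mode is positive, and higher modes oscillate slower. -/
theorem isMode_ne_zero_of_neg (ha : a ∈ delaunayParams) (h0 : a < 0) {j : ℕ} (hj : 1 ≤ j)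
    {w dw : ℝ → ℝ} (h : IsMode a j w dw) {T : ℝ} (hT : 0 < T) : w T ≠ 0 := by
  have hg : delaunayGamma a < 0 := mul_neg_of_neg_of_pos h0 (one_add_pos_of_mem ha)
  refine h.solves.ne_zero_of_comparison (solvesOn_sub_div ha (c := delaunayGamma a) rfl) (fun t => ?_)
    (fun t => ?_) (by rw [h.zero]; exact one_pos) h.deriv_zero
    (by simp [deriv_delaunayX_zero ha]) hT
  · have : (1 : ℝ) ≤ (j : ℝ) := by exact_mod_cast hj
    nlinarith
  · have hx := delaunayX_pos ha t
    have := div_neg_of_neg_of_pos hg hx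
    linarith

/-- The bound on `a` means `γ ≤ 1 / 2`, so that `p ≤ 2 + 4 γ ≤ 4 ≤ j²`. -/
theorem isMode_ne_zero_of_le (ha : a ∈ delaunayParams) (h0 : 0 < a) (h1 : a ≤ (√3 - 1) / 2) {j : ℕ}
    (hj : 2 ≤ j) {w dw : ℝ → ℝ} (h : IsMode a j w dw) {T : ℝ} (hT : 0 < T) : w T ≠ 0 := by
  have hone : SolvesOn (fun _ => 0) (fun _ => 1) (fun _ => 0) univ := fun t _ =>
    ⟨hasDerivAt_const _ _, (hasDerivAt_const _ _).congr_deriv (by ring)⟩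
  refine h.solves.ne_zero_of_comparison hone (fun t => ?_) (fun _ => one_pos)
    (by rw [h.zero]; exact one_pos) h.deriv_zero rfl hT
  have hj' : (2 : ℝ) ≤ (j : ℝ) := by exact_mod_cast hj
  have hp := jacobiPotential_le ha t
  have h3 : √3 ^ 2 = 3 := Real.sq_sqrt (by norm_num)
  have hg : delaunayGamma a ≤ 1 / 2 := by
    unfold delaunayGamma
    nlinarith [Real.sqrt_nonneg 3]
  nlinarith

/-- For large `a` one has `p - j² ≥ 4 γ - j² > 1`, so the mode vanishes before the cosine does. -/
theorem exists_zero_isMode_of_large (ha : a ∈ delaunayParams) (h0 : 0 < a) {j : ℕ}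
    (hj : (j : ℝ) ^ 2 < 4 * a) {w dw : ℝ → ℝ} (h : IsMode a j w dw) (h1 : 1 ≤ a) :
    ∃ T, 0 < T ∧ w T = 0 := by
  have hcos : SolvesOn (fun _ => -1) Real.cos (fun t => -Real.sin t) univ := fun t _ =>
    ⟨Real.hasDerivAt_cos t, (Real.hasDerivAt_sin t).neg.congr_deriv (by ring)⟩
  have hlt : ∀ t, (j : ℝ) ^ 2 - jacobiPotential a t < -1 := fun t => by
    have := four_mul_le_jacobiPotential ha t
    unfold delaunayGamma at this
    nlinarith
  obtain ⟨s, hs, hs0⟩ := h.solves.exists_zero_of_comparison hcos (b := Real.pi / 2)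
    (by positivity) hlt
    (fun t ht => Real.cos_pos_of_mem_Ioo ⟨by linarith [ht.1, Real.pi_pos], ht.2⟩)
    Real.cos_pi_div_two (by simp) (by rw [h.zero]; exact one_pos) h.deriv_zero (by simp)
  exact ⟨s, hs.1, hs0⟩

theorem delaunayX_of_eq_neg_half (h2 : a = -1 / 2) (t : ℝ) : delaunayX a t ^ 2 = 1 / 4 := by
  have ha : a ∈ delaunayParams := Or.inl ⟨by linarith, by linarith⟩
  have h := (delaunay_amplitude ha t).2
  rw [h, h2, delaunayGamma]
  norm_num

/-- On the cylinder the potential is constant, and the rotationally symmetric mode is the cosine. -/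
theorem zeros_isMode_zero_of_eq_neg_half (h2 : a = -1 / 2) {w dw : ℝ → ℝ}
    (h : IsMode a 0 w dw) :
    {t | 0 < t ∧ w t = 0} = range fun k : ℕ => ((k : ℝ) + 1 / 2) * Real.pi := by
  have ha : a ∈ delaunayParams := Or.inl ⟨by linarith, by linarith⟩
  have hcos : SolvesOn (fun t => ((0 : ℕ) : ℝ) ^ 2 - jacobiPotential a t) Real.cos
      (fun t => -Real.sin t) univ := fun t _ => by
    refine ⟨Real.hasDerivAt_cos t, (Real.hasDerivAt_sin t).neg.congr_deriv ?_⟩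
    have hg : delaunayGamma a = -1 / 4 := by rw [h2, delaunayGamma]; norm_num
    simp only [jacobiPotential, delaunayX_of_eq_neg_half h2, hg]
    norm_num
  have hw : w = Real.cos := (SolvesOn.eq (continuous_modePotential ha 0) h.solves hcos 0
    (by simp [h.zero]) (by simp [h.deriv_zero])).1
  ext T
  simp only [hw, mem_ofPred_eq, mem_range, Real.cos_eq_zero_iff]
  constructor
  · rintro ⟨hT, k, rfl⟩
    have hk : 0 ≤ k := by
      by_contra hcon
      have h1 : k ≤ -1 := by omega
      have h2 : (k : ℝ) ≤ -1 := by exact_mod_cast h1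
      nlinarith [Real.pi_pos]
    lift k to ℕ using hk
    exact ⟨k, by push_cast; ring⟩
  · rintro ⟨k, rfl⟩
    exact ⟨by positivity, k, by push_cast; ring⟩

end Modes

/-! ### The Jacobi operator -/

section Jacobi

/-- The vector with components `p, q, r` in the orthonormal frame
`e_r = (cos θ, sin θ, 0)`, `e_θ = (-sin θ, cos θ, 0)`, `e_z`. -/
noncomputable def frameVec (θ p q r : ℝ) : Fin 3 → ℝ :=
  ![p * Real.cos θ - q * Real.sin θ, p * Real.sin θ + q * Real.cos θ, r]

theorem frameVec_dotProduct (θ p q r p' q' r' : ℝ) :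
    frameVec θ p q r ⬝ᵥ frameVec θ p' q' r' = p * p' + q * q' + r * r' := by
  have h := Real.sin_sq_add_cos_sq θ
  simp only [frameVec, dotProduct, Fin.sum_univ_three, Matrix.cons_val_zero, Matrix.cons_val_one,
    Matrix.cons_val]
  linear_combination (p * p' + q * q') * h

theorem frameVec_cross (θ p q r p' q' r' : ℝ) :
    frameVec θ p q r ⨯₃ frameVec θ p' q' r' =
      frameVec θ (q * r' - r * q') (r * p' - p * r') (p * q' - q * p') := by
  have h := Real.sin_sq_add_cos_sq θ
  rw [frameVec, frameVec, cross_apply, frameVec]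
  simp only [Matrix.cons_val_zero, Matrix.cons_val_one, Matrix.cons_val]
  congr 1
  · ring
  congr 1
  · ring
  congr 1
  linear_combination (p * q' - q * p') * h

theorem smul_frameVec (c θ p q r : ℝ) :
    c • frameVec θ p q r = frameVec θ (c * p) (c * q) (c * r) := by
  ext i
  fin_cases i <;> simp [frameVec] <;> ring

theorem frameVec_add (θ p q r p' q' r' : ℝ) :
    frameVec θ p q r + frameVec θ p' q' r' = frameVec θ (p + p') (q + q') (r + r') := by
  ext i
  fin_cases i <;> simp [frameVec] <;> ring

theorem hasDerivWithinAt_frameVec {p q r : ℝ → ℝ} {p' q' r' t : ℝ} {I : Set ℝ} (θ : ℝ)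
    (hp : HasDerivWithinAt p p' I t) (hq : HasDerivWithinAt q q' I t)
    (hr : HasDerivWithinAt r r' I t) :
    HasDerivWithinAt (fun t => frameVec θ (p t) (q t) (r t)) (frameVec θ p' q' r') I t := by
  rw [hasDerivWithinAt_pi]
  intro i
  fin_cases i
  · exact (hp.mul_const _).sub (hq.mul_const _)
  · exact (hp.mul_const _).add (hq.mul_const _)
  · exact hr

theorem hasDerivAt_frameVec {p q r : ℝ → ℝ} {p' q' r' θ : ℝ} (hp : HasDerivAt p p' θ)
    (hq : HasDerivAt q q' θ) (hr : HasDerivAt r r' θ) :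
    HasDerivAt (fun θ => frameVec θ (p θ) (q θ) (r θ))
      (frameVec θ (p' - q θ) (q' + p θ) r') θ := by
  rw [hasDerivAt_pi]
  intro i
  have hs := Real.hasDerivAt_sin θ
  have hc := Real.hasDerivAt_cos θ
  fin_cases i
  · refine ((hp.mul hc).sub (hq.mul hs)).congr_deriv ?_
    simp [frameVec]; ring
  · refine ((hp.mul hs).add (hq.mul hc)).congr_deriv ?_
    simp [frameVec]; ring
  · exact hr

/-- The mean curvature as a function of the five first and second partial derivatives
`X_t, X_θ, X_tt, X_tθ, X_θθ`. -/
noncomputable def curvatureOfJet (Xt Xθ Xtt Xtθ Xθθ : Fin 3 → ℝ) : ℝ :=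
  let ν := (√((Xt ⨯₃ Xθ) ⬝ᵥ (Xt ⨯₃ Xθ)))⁻¹ • (Xt ⨯₃ Xθ)
  ((Xt ⬝ᵥ Xt) * (Xθθ ⬝ᵥ ν) - 2 * (Xt ⬝ᵥ Xθ) * (Xtθ ⬝ᵥ ν) + (Xθ ⬝ᵥ Xθ) * (Xtt ⬝ᵥ ν)) /
    (2 * ((Xt ⬝ᵥ Xt) * (Xθ ⬝ᵥ Xθ) - (Xt ⬝ᵥ Xθ) ^ 2))

theorem meanCurvature_eq_curvatureOfJet (I : Set ℝ) (X : ℝ → ℝ → Fin 3 → ℝ) (t θ : ℝ) :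
    meanCurvature I X t θ = curvatureOfJet (partialT I X t θ) (partialTheta X t θ)
      (partialT I (partialT I X) t θ) (partialTheta (partialT I X) t θ)
      (partialTheta (partialTheta X) t θ) := rfl

theorem curvatureOfJet_eq (Xt Xθ Xtt Xtθ Xθθ : Fin 3 → ℝ) :
    curvatureOfJet Xt Xθ Xtt Xtθ Xθθ =
      ((Xt ⬝ᵥ Xt) * (Xθθ ⬝ᵥ (Xt ⨯₃ Xθ)) - 2 * ((Xt ⬝ᵥ Xθ) * (Xtθ ⬝ᵥ (Xt ⨯₃ Xθ))) +
        (Xθ ⬝ᵥ Xθ) * (Xtt ⬝ᵥ (Xt ⨯₃ Xθ))) /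
      (2 * ((Xt ⬝ᵥ Xt) * (Xθ ⬝ᵥ Xθ) - (Xt ⬝ᵥ Xθ) * (Xt ⬝ᵥ Xθ)) *
        √((Xt ⨯₃ Xθ) ⬝ᵥ (Xt ⨯₃ Xθ))) := by
  simp only [curvatureOfJet, dotProduct_smul, smul_eq_mul, div_eq_mul_inv, mul_inv]
  ring

theorem hasDerivAt_affine (c d : ℝ) : HasDerivAt (fun s : ℝ => c + s * d) d 0 := by
  simpa using ((hasDerivAt_id (0 : ℝ)).mul_const d).const_add c

/-- First variation of `(E N - 2 F M + G L) / (2 (E G - F²) √Q)` at a conformal point with vanishing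
mixed coefficients. -/
theorem hasDerivAt_curvatureQuotient {E F G L M N Q : ℝ → ℝ} {E' F' G' L' M' N' Q' x : ℝ}
    (hx : 0 < x) (hE : HasDerivAt E E' 0) (hF : HasDerivAt F F' 0) (hG : HasDerivAt G G' 0)
    (hL : HasDerivAt L L' 0) (hM : HasDerivAt M M' 0) (hN : HasDerivAt N N' 0)
    (hQ : HasDerivAt Q Q' 0) (hE0 : E 0 = x ^ 2) (hF0 : F 0 = 0) (hG0 : G 0 = x ^ 2)
    (hM0 : M 0 = 0) (hQ0 : Q 0 = (x ^ 2) ^ 2) :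
    HasDerivAt (fun s => (E s * N s - 2 * (F s * M s) + G s * L s) /
      (2 * (E s * G s - F s * F s) * √(Q s)))
      ((E' * N 0 + G' * L 0 + x ^ 2 * (N' + L')) / (2 * x ^ 6) -
        (N 0 + L 0) * ((E' + G') / (2 * x ^ 6) + Q' / (4 * x ^ 8))) 0 := by
  have hsq : √(Q 0) = x ^ 2 := by rw [hQ0, Real.sqrt_sq (by positivity)]
  have hP := ((hE.mul hN).sub ((hF.mul hM).const_mul 2)).add (hG.mul hL)
  have hD := (((hE.mul hG).sub (hF.mul hF)).const_mul 2).mul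
    (hQ.sqrt (by rw [hQ0]; positivity))
  refine (hP.div hD ?_).congr_deriv ?_
  · simp only [Pi.mul_apply, Pi.sub_apply, hsq, hE0, hF0, hG0]
    have : 2 * (x ^ 2 * x ^ 2 - 0 * 0) * x ^ 2 = 2 * x ^ 6 := by ring
    rw [this]
    positivity
  · simp only [Pi.mul_apply, Pi.sub_apply, Pi.add_apply, hsq, hE0, hF0, hG0, hM0]
    field_simp
    ring

/-- First variation of the mean curvature at a conformal jet of a surface of revolution, with
profile derivatives `(x₁, z₁)`, `(x₂, z₂)` and radius `x`. -/
theorem hasDerivAt_curvatureOfJet {x x₁ z₁ : ℝ} (x₂ z₂ : ℝ) (hx : 0 < x)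
    (hconf : x₁ ^ 2 + z₁ ^ 2 = x ^ 2) (θ a₁ a₃ b₁ b₂ b₃ c₁ c₃ d₁ d₂ d₃ e₁ e₂ e₃ : ℝ) :
    HasDerivAt (fun s : ℝ => curvatureOfJet
      (frameVec θ (x₁ + s * a₁) 0 (z₁ + s * a₃))
      (frameVec θ (0 + s * b₁) (x + s * b₂) (0 + s * b₃))
      (frameVec θ (x₂ + s * c₁) 0 (z₂ + s * c₃))
      (frameVec θ (0 + s * d₁) (x₁ + s * d₂) (0 + s * d₃))
      (frameVec θ (-x + s * e₁) (0 + s * e₂) (0 + s * e₃)))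
      ((2 * (x₁ * a₁ + z₁ * a₃) * (x ^ 2 * z₁) + 2 * x * b₂ * (x * (x₁ * z₂ - x₂ * z₁)) +
        x ^ 2 * ((-e₁ * z₁ * x + x ^ 2 * a₃ + x * z₁ * b₂ + e₃ * x₁ * x) +
          (-c₁ * z₁ * x - x₂ * a₃ * x - x₂ * z₁ * b₂ + c₃ * x₁ * x + z₂ * a₁ * x +
            z₂ * x₁ * b₂))) / (2 * x ^ 6) -
        3 / 4 * (x ^ 2 * z₁ + x * (x₁ * z₂ - x₂ * z₁)) *
          (2 * (x₁ * a₁ + z₁ * a₃) + 2 * x * b₂) / x ^ 6) 0 := by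
  have A1 := hasDerivAt_affine x₁ a₁
  have A3 := hasDerivAt_affine z₁ a₃
  have B1 := hasDerivAt_affine 0 b₁
  have B2 := hasDerivAt_affine x b₂
  have B3 := hasDerivAt_affine 0 b₃
  have C1 := hasDerivAt_affine x₂ c₁
  have C3 := hasDerivAt_affine z₂ c₃
  have D1 := hasDerivAt_affine 0 d₁
  have D2 := hasDerivAt_affine x₁ d₂
  have D3 := hasDerivAt_affine 0 d₃
  have E1 := hasDerivAt_affine (-x) e₁
  have E2 := hasDerivAt_affine 0 e₂
  have E3 := hasDerivAt_affine 0 e₃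
  -- the components of `X_t ∧ X_θ`
  have n1 : HasDerivAt (fun s => 0 * (0 + s * b₃) - (z₁ + s * a₃) * (x + s * b₂))
      (-(a₃ * x + z₁ * b₂)) 0 :=
    ((B3.const_mul 0).sub (A3.mul B2)).congr_deriv (by ring)
  have n2 : HasDerivAt (fun s => (z₁ + s * a₃) * (0 + s * b₁) - (x₁ + s * a₁) * (0 + s * b₃))
      (z₁ * b₁ - x₁ * b₃) 0 :=
    ((A3.mul B1).sub (A1.mul B3)).congr_deriv (by ring)
  have n3 : HasDerivAt (fun s => (x₁ + s * a₁) * (x + s * b₂) - 0 * (0 + s * b₁))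
      (a₁ * x + x₁ * b₂) 0 :=
    ((A1.mul B2).sub (B1.const_mul 0)).congr_deriv (by ring)
  have hQ := ((n1.mul n1).add (n2.mul n2)).add (n3.mul n3)
  have hE := ((A1.mul A1).add (hasDerivAt_const (0 : ℝ) ((0 : ℝ) * 0))).add (A3.mul A3)
  have hF := ((A1.mul B1).add (B2.const_mul 0)).add (A3.mul B3)
  have hG := ((B1.mul B1).add (B2.mul B2)).add (B3.mul B3)
  have hL := ((C1.mul n1).add (n2.const_mul 0)).add (C3.mul n3)
  have hM := ((D1.mul n1).add (D2.mul n2)).add (D3.mul n3)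
  have hN := ((E1.mul n1).add (E2.mul n2)).add (E3.mul n3)
  have hH := hasDerivAt_curvatureQuotient hx hE hF hG hL hM hN hQ
    (by simp only [Pi.mul_apply, Pi.add_apply]; linear_combination hconf)
    (by simp only [Pi.mul_apply, Pi.add_apply]; ring)
    (by simp only [Pi.mul_apply, Pi.add_apply]; ring)
    (by simp only [Pi.mul_apply, Pi.add_apply]; ring)
    (by simp only [Pi.mul_apply, Pi.add_apply]; linear_combination x ^ 2 * hconf)
  simp only [curvatureOfJet_eq, frameVec_cross, frameVec_dotProduct]
  refine hH.congr_deriv ?_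
  simp only [Pi.mul_apply, Pi.add_apply, zero_mul, add_zero, mul_zero, zero_sub, sub_zero,
    zero_add]
  field_simp
  linear_combination (-4 * (z₁ * x + x₁ * z₂ - z₁ * x₂) * b₂) * hconf

/-- `φt, φθ, φtt, φtθ, φθθ` are the partial derivatives of `φ` on `I × ℝ`, those in `t` being taken
within `I`. -/
structure HasPartials (I : Set ℝ) (φ φt φθ φtt φtθ φθθ : ℝ → ℝ → ℝ) : Prop where
  t : ∀ t ∈ I, ∀ θ, HasDerivWithinAt (fun s => φ s θ) (φt t θ) I t
  θ : ∀ t ∈ I, ∀ θ, HasDerivAt (φ t) (φθ t θ) θ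
  tt : ∀ t ∈ I, ∀ θ, HasDerivWithinAt (fun s => φt s θ) (φtt t θ) I t
  tθ : ∀ t ∈ I, ∀ θ, HasDerivAt (φt t) (φtθ t θ) θ
  θθ : ∀ t ∈ I, ∀ θ, HasDerivAt (φθ t) (φθθ t θ) θ

variable {a : ℝ}

theorem delaunaySurface_eq (a t θ : ℝ) :
    delaunaySurface a t θ = frameVec θ (delaunayX a t) 0 (delaunayZ a t) := by
  simp [delaunaySurface, frameVec]

theorem unitNormal_delaunaySurface (ha : a ∈ delaunayParams) (t θ : ℝ) :
    unitNormal univ (delaunaySurface a) t θ =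
      frameVec θ (-(delaunayX a t - delaunayGamma a / delaunayX a t)) 0
        (deriv (delaunayX a) t / delaunayX a t) := by
  have hx := delaunayX_pos ha t
  have h1 : partialT univ (delaunaySurface a) t θ =
      frameVec θ (deriv (delaunayX a) t) 0 (delaunayX a t ^ 2 - delaunayGamma a) := by
    simp only [partialT, delaunaySurface_eq]
    exact (hasDerivWithinAt_frameVec θ (hasDerivAt_delaunayX ha t).hasDerivWithinAt
      (hasDerivAt_const t 0).hasDerivWithinAt
      ((isDelaunayProfile ha).ode_z t).hasDerivWithinAt).derivWithin uniqueDiffWithinAt_univ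
  have h2 : partialTheta (delaunaySurface a) t θ = frameVec θ 0 (delaunayX a t) 0 := by
    have e : delaunaySurface a t = fun θ => frameVec θ (delaunayX a t) 0 (delaunayZ a t) :=
      funext fun θ => delaunaySurface_eq a t θ
    simp only [partialTheta, e]
    refine (hasDerivAt_frameVec (hasDerivAt_const θ _) (hasDerivAt_const θ 0)
      (hasDerivAt_const θ _)).deriv.trans ?_
    simp
  have hsq := deriv_delaunayX_sq ha t
  have hQ : √(frameVec θ (0 * 0 - (delaunayX a t ^ 2 - delaunayGamma a) * delaunayX a t)
      ((delaunayX a t ^ 2 - delaunayGamma a) * 0 - deriv (delaunayX a) t * 0)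
      (deriv (delaunayX a) t * delaunayX a t - 0 * 0) ⬝ᵥ
      frameVec θ (0 * 0 - (delaunayX a t ^ 2 - delaunayGamma a) * delaunayX a t)
      ((delaunayX a t ^ 2 - delaunayGamma a) * 0 - deriv (delaunayX a) t * 0)
      (deriv (delaunayX a) t * delaunayX a t - 0 * 0)) = delaunayX a t ^ 2 := by
    rw [frameVec_dotProduct]
    refine (congrArg Real.sqrt ?_).trans (Real.sqrt_sq (sq_nonneg (delaunayX a t)))
    linear_combination delaunayX a t ^ 2 * hsq
  simp only [unitNormal, h1, h2, frameVec_cross, hQ, smul_frameVec]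
  have := hx.ne'
  congr 1 <;> field_simp <;> ring

theorem normalGraph_mul (ha : a ∈ delaunayParams) (φ : ℝ → ℝ → ℝ) (s t θ : ℝ) :
    normalGraph a (fun t θ => s * φ t θ) t θ =
      frameVec θ (delaunayX a t +
          s * -(φ t θ * (delaunayX a t - delaunayGamma a / delaunayX a t))) 0
        (delaunayZ a t + s * (φ t θ * (deriv (delaunayX a) t / delaunayX a t))) := by
  rw [normalGraph, unitNormal_delaunaySurface ha, delaunaySurface_eq, smul_frameVec, frameVec_add]
  congr 1 <;> ring

/-- The first variation of the mean curvature of `X_a` in the direction `φ N_a` is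
`(φ_tt + φ_θθ + p φ) / (2 x²)`. -/
theorem hasDerivAt_meanCurvature_normalGraph (ha : a ∈ delaunayParams) {I : Set ℝ}
    (hI : UniqueDiffOn ℝ I) {φ φt φθ φtt φtθ φθθ : ℝ → ℝ → ℝ}
    (hφ : HasPartials I φ φt φθ φtt φtθ φθθ) {t : ℝ} (ht : t ∈ I) (θ : ℝ) :
    HasDerivAt (fun s : ℝ => meanCurvature I (normalGraph a fun t θ => s * φ t θ) t θ)
      ((φtt t θ + φθθ t θ + jacobiPotential a t * φ t θ) / (2 * delaunayX a t ^ 2)) 0 := by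
  have hn := solvesOn_sub_div ha (c := delaunayGamma a) rfl
  have hm := solvesOn_logDeriv ha
  have hsq := deriv_delaunayX_sq ha t
  have hxt := (delaunayX_pos ha t)
  have hxd := hasDerivAt_delaunayX ha
  have hxdd := hasDerivAt_deriv_delaunayX ha
  have hzd := (isDelaunayProfile ha).ode_z
  simp only [add_sub_cancel_right] at hn
  have hpdef : jacobiPotential a t =
    2 * (delaunayX a t ^ 2 + delaunayGamma a ^ 2 / delaunayX a t ^ 2) := rfl
  set x := delaunayX a
  set g := delaunayGamma a
  set p := jacobiPotential a
  set z := delaunayZ a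
  set n : ℝ → ℝ := fun t => x t - g / x t with hndef
  set dn : ℝ → ℝ := fun t => deriv x t * (1 + g / x t ^ 2) with hdndef
  set m : ℝ → ℝ := fun t => deriv x t / x t with hmdef
  set dm : ℝ → ℝ := fun t => g ^ 2 / x t ^ 2 - x t ^ 2 with hdmdef
  have hY : ∀ s t θ, normalGraph a (fun t θ => s * φ t θ) t θ =
      frameVec θ (x t + s * -(φ t θ * n t)) 0 (z t + s * (φ t θ * m t)) := fun s t θ =>
    normalGraph_mul ha φ s t θ
  have hYt : ∀ s, ∀ t ∈ I, ∀ θ, partialT I (normalGraph a fun t θ => s * φ t θ) t θ =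
      frameVec θ (deriv x t + s * -(φt t θ * n t + φ t θ * dn t)) 0
        (x t ^ 2 - g + s * (φt t θ * m t + φ t θ * dm t)) := by
    intro s t ht θ
    simp only [partialT, hY]
    exact (hasDerivWithinAt_frameVec θ
      ((hxd t).hasDerivWithinAt.add
        (((hφ.t t ht θ).mul (hn t trivial).1.hasDerivWithinAt).neg.const_mul s))
      (hasDerivAt_const t 0).hasDerivWithinAt
      ((hzd t).hasDerivWithinAt.add
        (((hφ.t t ht θ).mul (hm t trivial).1.hasDerivWithinAt).const_mul s))).derivWithin (hI t ht)
  have hYθ : ∀ s, ∀ θ, partialTheta (normalGraph a fun t θ => s * φ t θ) t θ =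
      frameVec θ (0 + s * -(φθ t θ * n t)) (x t + s * -(φ t θ * n t))
        (0 + s * (φθ t θ * m t)) := by
    intro s θ
    simp only [partialTheta]
    rw [funext (hY s t)]
    refine (hasDerivAt_frameVec
      ((hasDerivAt_const θ (x t)).add (((hφ.θ t ht θ).mul_const (n t)).neg.const_mul s))
      (hasDerivAt_const θ 0)
      ((hasDerivAt_const θ (z t)).add (((hφ.θ t ht θ).mul_const (m t)).const_mul s))).deriv.trans ?_
    simp only [Pi.add_apply, Pi.neg_apply]
    congr 1 <;> ring
  have hYtt : ∀ s, partialT I (partialT I (normalGraph a fun t θ => s * φ t θ)) t θ =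
      frameVec θ ((1 + 2 * g) * x t - 2 * x t ^ 3 +
          s * -(φtt t θ * n t + 2 * (φt t θ * dn t) + φ t θ * ((1 - p t) * n t))) 0
        (2 * x t * deriv x t +
          s * (φtt t θ * m t + 2 * (φt t θ * dm t) + φ t θ * (-p t * m t))) := by
    intro s
    rw [partialT, derivWithin_congr (fun t ht => hYt s t ht θ) (hYt s t ht θ)]
    refine ((hasDerivWithinAt_frameVec θ
      ((hxdd t).hasDerivWithinAt.add
        ((((hφ.tt t ht θ).mul (hn t trivial).1.hasDerivWithinAt).add
          ((hφ.t t ht θ).mul (hn t trivial).2.hasDerivWithinAt)).neg.const_mul s))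
      (hasDerivAt_const t 0).hasDerivWithinAt
      ((((hxd t).pow 2).sub_const g).hasDerivWithinAt.add
        ((((hφ.tt t ht θ).mul (hm t trivial).1.hasDerivWithinAt).add
          ((hφ.t t ht θ).mul (hm t trivial).2.hasDerivWithinAt)).const_mul s))).derivWithin
          (hI t ht)).trans ?_
    congr 1
    · simp only [hdndef, hndef]; ring
    · simp only [hdmdef, hmdef, Nat.cast_ofNat, Nat.add_one_sub_one, pow_one]; ring
  have hYtθ : ∀ s, partialTheta (partialT I (normalGraph a fun t θ => s * φ t θ)) t θ =
      frameVec θ (0 + s * -(φtθ t θ * n t + φθ t θ * dn t))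
        (deriv x t + s * -(φt t θ * n t + φ t θ * dn t))
        (0 + s * (φtθ t θ * m t + φθ t θ * dm t)) := by
    intro s
    rw [partialTheta, funext (hYt s t ht)]
    refine (hasDerivAt_frameVec
      ((hasDerivAt_const θ _).add ((((hφ.tθ t ht θ).mul_const (n t)).add
        ((hφ.θ t ht θ).mul_const (dn t))).neg.const_mul s))
      (hasDerivAt_const θ 0)
      ((hasDerivAt_const θ _).add ((((hφ.tθ t ht θ).mul_const (m t)).add
        ((hφ.θ t ht θ).mul_const (dm t))).const_mul s))).deriv.trans ?_
    simp only [Pi.add_apply, Pi.neg_apply]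
    congr 1 <;> ring
  have hYθθ : ∀ s, partialTheta (partialTheta (normalGraph a fun t θ => s * φ t θ)) t θ =
      frameVec θ (-x t + s * (-(φθθ t θ * n t) + φ t θ * n t))
        (0 + s * (-2 * (φθ t θ * n t))) (0 + s * (φθθ t θ * m t)) := by
    intro s
    rw [partialTheta, funext (hYθ s)]
    refine (hasDerivAt_frameVec
      ((hasDerivAt_const θ _).add (((hφ.θθ t ht θ).mul_const (n t)).neg.const_mul s))
      ((hasDerivAt_const θ _).add (((hφ.θ t ht θ).mul_const (n t)).neg.const_mul s))
      ((hasDerivAt_const θ _).add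
        (((hφ.θθ t ht θ).mul_const (m t)).const_mul s))).deriv.trans ?_
    simp only [Pi.add_apply, Pi.neg_apply]
    congr 1 <;> ring
  simp only [meanCurvature_eq_curvatureOfJet, hYt _ t ht, hYθ, hYtt, hYtθ, hYθθ]
  refine (hasDerivAt_curvatureOfJet ((1 + 2 * g) * x t - 2 * x t ^ 3) (2 * x t * deriv x t) hxt
    (by linarith) θ _ _ _ _ _ _ _ _ _ _ _ _ _).congr_deriv ?_
  simp only [hndef, hdndef, hmdef, hdmdef, hpdef]
  clear hYθθ hYtθ hYtt hYθ hYt hY hm hn hpdef hndef hdndef hmdef hdmdef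
  generalize x t = X at *
  generalize deriv x t = Y at *
  generalize φ t θ = f
  generalize φt t θ = ft
  generalize φθ t θ = fh
  generalize φtt t θ = ftt
  generalize φtθ t θ = fth
  generalize φθθ t θ = fhh
  have hy4 : Y ^ 4 = (X ^ 2 - (X ^ 2 - g) ^ 2) ^ 2 := by rw [← hsq]; ring
  field_simp
  ring_nf
  simp only [hsq, hy4]
  ring

end Jacobi

/-! ### The Jacobi equation and the zeros of the modes -/

section JacobiEquation

variable {a : ℝ}

theorem jacobiEq_iff (ha : a ∈ delaunayParams) {I : Set ℝ} (hI : UniqueDiffOn ℝ I)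
    {φ φt φθ φtt φtθ φθθ : ℝ → ℝ → ℝ} (hφ : HasPartials I φ φt φθ φtt φtθ φθθ) :
    JacobiEq I a φ ↔
      ∀ t ∈ I, ∀ θ, φtt t θ + φθθ t θ + jacobiPotential a t * φ t θ = 0 := by
  refine forall₂_congr fun t ht => forall_congr' fun θ => ?_
  have h := hasDerivAt_meanCurvature_normalGraph ha hI hφ ht θ
  have hx := delaunayX_pos ha t
  constructor
  · intro h0
    have := h.unique h0
    rw [div_eq_zero_iff] at this
    exact this.resolve_right (by positivity)
  · intro h0
    rw [h0, zero_div] at h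
    exact h

theorem hasDerivWithinAt_partialT {I : Set ℝ} (hI : UniqueDiffOn ℝ I) {φ : ℝ → ℝ → ℝ} {n : WithTop ℕ∞}
    (hn : n ≠ 0) (hφ : ContDiffOn ℝ n (Function.uncurry φ) (I ×ˢ univ)) :
    (∀ t ∈ I, ∀ θ, HasDerivWithinAt (fun s => φ s θ) (partialT I φ t θ) I t) ∧
    ∀ t ∈ I, ∀ θ, partialT I φ t θ =
      fderivWithin ℝ (Function.uncurry φ) (I ×ˢ univ) (t, θ) (1, 0) := by
  have key : ∀ t ∈ I, ∀ θ, HasDerivWithinAt (fun s => φ s θ)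
      (fderivWithin ℝ (Function.uncurry φ) (I ×ˢ univ) (t, θ) (1, 0)) I t := by
    intro t ht θ
    have h1 := ((hφ.differentiableOn hn) (t, θ) ⟨ht, trivial⟩).hasFDerivWithinAt
    have h2 : HasDerivWithinAt (fun s : ℝ => (s, θ)) (1, 0) I t :=
      (hasDerivWithinAt_id t I).prodMk (hasDerivWithinAt_const t I θ)
    have hmaps : MapsTo (fun s : ℝ => (s, θ)) I (I ×ˢ univ) := fun s hs => ⟨hs, trivial⟩
    exact h1.comp_hasDerivWithinAt t h2 hmaps
  have heq := fun t ht θ => (key t ht θ).derivWithin (hI t ht)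
  exact ⟨fun t ht θ => by rw [partialT, heq t ht θ]; exact key t ht θ, heq⟩

theorem hasDerivAt_partialTheta {I : Set ℝ} {φ : ℝ → ℝ → ℝ} {n : WithTop ℕ∞}
    (hn : n ≠ 0) (hφ : ContDiffOn ℝ n (Function.uncurry φ) (I ×ˢ univ)) :
    (∀ t ∈ I, ∀ θ, HasDerivAt (φ t) (partialTheta φ t θ) θ) ∧
    ∀ t ∈ I, ∀ θ, partialTheta φ t θ =
      fderivWithin ℝ (Function.uncurry φ) (I ×ˢ univ) (t, θ) (0, 1) := by
  have key : ∀ t ∈ I, ∀ θ, HasDerivAt (φ t)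
      (fderivWithin ℝ (Function.uncurry φ) (I ×ˢ univ) (t, θ) (0, 1)) θ := by
    intro t ht θ
    have h1 := ((hφ.differentiableOn hn) (t, θ) ⟨ht, trivial⟩).hasFDerivWithinAt
    have h2 : HasDerivWithinAt (fun s : ℝ => (t, s)) (0, 1) univ θ :=
      (hasDerivWithinAt_const θ univ t).prodMk (hasDerivWithinAt_id θ univ)
    have hmaps : MapsTo (fun s : ℝ => (t, s)) univ (I ×ˢ univ) := fun s _ => ⟨ht, trivial⟩
    exact (h1.comp_hasDerivWithinAt θ h2 hmaps).hasDerivAt univ_mem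
  have heq := fun t ht θ => (key t ht θ).deriv
  exact ⟨fun t ht θ => by rw [partialTheta, heq t ht θ]; exact key t ht θ, heq⟩

theorem contDiffOn_partialT {I : Set ℝ} (hI : UniqueDiffOn ℝ I) {φ : ℝ → ℝ → ℝ}
    {m n : WithTop ℕ∞} (hmn : m + 1 ≤ n) (hφ : ContDiffOn ℝ n (Function.uncurry φ) (I ×ˢ univ)) :
    ContDiffOn ℝ m (Function.uncurry (partialT I φ)) (I ×ˢ univ) := by
  have hn : n ≠ 0 := by rintro rfl; simp at hmn
  refine ((hφ.fderivWithin (hI.prod uniqueDiffOn_univ) hmn).clm_apply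
    (contDiffOn_const (c := ((1 : ℝ), (0 : ℝ))))).congr ?_
  rintro ⟨t, θ⟩ ⟨ht, -⟩
  exact (hasDerivWithinAt_partialT hI hn hφ).2 t ht θ

theorem contDiffOn_partialTheta {I : Set ℝ} (hI : UniqueDiffOn ℝ I) {φ : ℝ → ℝ → ℝ}
    {m n : WithTop ℕ∞} (hmn : m + 1 ≤ n) (hφ : ContDiffOn ℝ n (Function.uncurry φ) (I ×ˢ univ)) :
    ContDiffOn ℝ m (Function.uncurry (partialTheta φ)) (I ×ˢ univ) := by
  have hn : n ≠ 0 := by rintro rfl; simp at hmn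
  refine ((hφ.fderivWithin (hI.prod uniqueDiffOn_univ) hmn).clm_apply
    (contDiffOn_const (c := ((0 : ℝ), (1 : ℝ))))).congr ?_
  rintro ⟨t, θ⟩ ⟨ht, -⟩
  exact (hasDerivAt_partialTheta hn hφ).2 t ht θ

/-- A `C²` function on `I × ℝ` has all partial derivatives up to order two, including one-sided
ones at the end points of `I`. -/
theorem hasPartials_of_contDiffOn {I : Set ℝ} (hI : UniqueDiffOn ℝ I) {φ : ℝ → ℝ → ℝ}
    (hφ : ContDiffOn ℝ 2 (Function.uncurry φ) (I ×ˢ univ)) :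
    HasPartials I φ (partialT I φ) (partialTheta φ) (partialT I (partialT I φ))
      (partialTheta (partialT I φ)) (partialTheta (partialTheta φ)) := by
  have h11 : (1 : WithTop ℕ∞) + 1 ≤ 2 := by norm_num
  have ht := contDiffOn_partialT hI h11 hφ
  have hθ := contDiffOn_partialTheta hI h11 hφ
  exact ⟨(hasDerivWithinAt_partialT hI two_ne_zero hφ).1,
    (hasDerivAt_partialTheta two_ne_zero hφ).1, (hasDerivWithinAt_partialT hI one_ne_zero ht).1,
    (hasDerivAt_partialTheta one_ne_zero ht).1, (hasDerivAt_partialTheta one_ne_zero hθ).1⟩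

theorem hasDerivAt_cos_mul (j θ : ℝ) :
    HasDerivAt (fun θ => Real.cos (j * θ)) (-(j * Real.sin (j * θ))) θ :=
  (((hasDerivAt_id θ).const_mul j).cos).congr_deriv (by simp [mul_comm])

theorem hasDerivAt_sin_mul (j θ : ℝ) :
    HasDerivAt (fun θ => Real.sin (j * θ)) (j * Real.cos (j * θ)) θ :=
  (((hasDerivAt_id θ).const_mul j).sin).congr_deriv (by simp [mul_comm])

/-- Partial derivatives of a separated function `w(t) cos(jθ)`. -/
theorem hasPartials_mul_cos {q w dw : ℝ → ℝ} (hw : SolvesOn q w dw univ) (I : Set ℝ) (j : ℕ) :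
    HasPartials I (fun t θ => w t * Real.cos (j * θ)) (fun t θ => dw t * Real.cos (j * θ))
      (fun t θ => w t * -(j * Real.sin (j * θ))) (fun t θ => q t * w t * Real.cos (j * θ))
      (fun t θ => dw t * -(j * Real.sin (j * θ)))
      (fun t θ => w t * -(j * (j * Real.cos (j * θ)))) where
  t t _ _ := ((hw t trivial).1.mul_const _).hasDerivWithinAt
  θ _ _ θ := (hasDerivAt_cos_mul j θ).const_mul _
  tt t _ _ := ((hw t trivial).2.mul_const _).hasDerivWithinAt
  tθ _ _ θ := (hasDerivAt_cos_mul j θ).const_mul _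
  θθ _ _ θ := ((hasDerivAt_sin_mul j θ).const_mul (j : ℝ)).neg.const_mul _

theorem IsMode.jacobiEq (ha : a ∈ delaunayParams) {j : ℕ} {w dw : ℝ → ℝ} (h : IsMode a j w dw)
    {I : Set ℝ} (hI : UniqueDiffOn ℝ I) : JacobiEq I a fun t θ => w t * Real.cos (j * θ) := by
  rw [jacobiEq_iff ha hI (hasPartials_mul_cos h.solves I j)]
  intro t _ θ
  ring

theorem SolvesOn.contDiff {q w dw : ℝ → ℝ} (hq : Continuous q) (h : SolvesOn q w dw univ) :
    ContDiff ℝ 2 w := by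
  have hd : deriv w = dw := funext fun t => (h t trivial).1.deriv
  have hdd : deriv dw = fun t => q t * w t := funext fun t => (h t trivial).2.deriv
  have h1 : ContDiff ℝ 1 (deriv w) := by
    rw [hd, contDiff_one_iff_deriv, hdd]
    exact ⟨fun t => (h t trivial).2.differentiableAt, hq.mul h.continuous⟩
  have : ContDiff ℝ (1 + 1) w :=
    contDiff_succ_iff_deriv.2 ⟨fun t => (h t trivial).1.differentiableAt, by simp, h1⟩
  simpa [one_add_one_eq_two] using this

/-- `𝒯_{a,j}` is the set of positive zeros of the `j`-th mode. -/
theorem modeDegeneracySet_eq (ha : a ∈ delaunayParams) {j : ℕ} {w dw : ℝ → ℝ}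
    (h : IsMode a j w dw) : modeDegeneracySet a j = {t | 0 < t ∧ w t = 0} := by
  ext T
  constructor
  · rintro ⟨hT, φ, v, hv, hφ, hc, hne, hJ, h0⟩
    refine ⟨hT, ?_⟩
    have hp := hasPartials_of_contDiffOn uniqueDiffOn_univ (φ := φ)
      (by rw [univ_prod_univ]; exact hc.contDiffOn)
    rw [jacobiEq_iff ha uniqueDiffOn_univ hp] at hJ
    have hφ0 : (fun t => φ t 0) = v := funext fun t => by simp [hφ]
    have hφf : ∀ t, φ t = fun θ => v t * Real.cos (j * θ) := fun t => funext (hφ t)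
    have hθθ : ∀ t, partialTheta (partialTheta φ) t 0 = -((j : ℝ) ^ 2 * v t) := by
      intro t
      have e : partialTheta φ t = fun θ => v t * -(j * Real.sin (j * θ)) := by
        funext θ
        simp only [partialTheta, hφf t]
        exact ((hasDerivAt_cos_mul j θ).const_mul _).deriv
      rw [partialTheta, e]
      refine (((hasDerivAt_sin_mul j 0).const_mul (j : ℝ)).neg.const_mul (v t)).deriv.trans ?_
      rw [mul_zero, Real.cos_zero]
      ring
    have hs : SolvesOn (fun t => (j : ℝ) ^ 2 - jacobiPotential a t) v
        (fun t => partialT univ φ t 0) univ := by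
      intro t _
      refine ⟨by rw [← hφ0]; exact (hp.t t trivial 0).hasDerivAt univ_mem,
        ((hp.tt t trivial 0).hasDerivAt univ_mem).congr_deriv ?_⟩
      have e := hJ t trivial 0
      rw [hθθ, congrFun hφ0 t] at e
      linarith
    have hmul := SolvesOn.eq_smul_of_even (continuous_modePotential ha j) hs h.solves h.zero
      h.deriv_zero hv
    have hv0 : v 0 ≠ 0 := by
      intro hv0
      apply hne
      funext t θ
      rw [hφ, hmul, hv0]
      simp
    have hvT : v T = 0 := by rw [← congrFun hφ0 T]; exact h0 0
    rw [hmul T] at hvT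
    exact (mul_eq_zero.1 hvT).resolve_left hv0
  · rintro ⟨hT, hT0⟩
    refine ⟨hT, _, w, h.even ha, fun _ _ => rfl, ?_, ?_, h.jacobiEq ha uniqueDiffOn_univ, ?_⟩
    · have hw := h.solves.contDiff (continuous_modePotential ha j)
      have h1 : ContDiff ℝ 2 fun y : ℝ × ℝ => w y.1 := hw.comp contDiff_fst
      have h2 : ContDiff ℝ 2 fun y : ℝ × ℝ => Real.cos (j * y.2) :=
        Real.contDiff_cos.comp (contDiff_const.mul contDiff_snd)
      exact h1.mul h2
    · intro h0
      have := congrFun (congrFun h0 0) 0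
      simp [h.zero] at this
    · intro θ
      simp [hT0]

/-! ### Separated functions are Hölder continuous -/

/-- A product `v(t) c(θ)` with `v` of class `C¹` and `c`, `c'` bounded is Hölder continuous on
`[-T, T] × ℝ`: it is bounded and Lipschitz. -/
theorem exists_holderOnWith_mul {α : ℝ≥0} (hα : α ≤ 1) {T : ℝ} {v dv c dc : ℝ → ℝ}
    (hv : ∀ t, HasDerivAt v (dv t) t) (hdv : Continuous dv) (hc : ∀ θ, HasDerivAt c (dc θ) θ)
    {B : ℝ} (hcB : ∀ θ, |c θ| ≤ B) (hdcB : ∀ θ, |dc θ| ≤ B) {f : ℝ × ℝ → ℝ}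
    (hf : ∀ y ∈ Icc (-T) T ×ˢ (univ : Set ℝ), f y = v y.1 * c y.2) :
    ∃ C, HolderOnWith C α f (Icc (-T) T ×ˢ univ) := by
  have hvc : Continuous v := continuous_iff_continuousAt.2 fun t => (hv t).continuousAt
  obtain ⟨V, hV⟩ := (isCompact_Icc (a := -T) (b := T)).exists_bound_of_continuousOn hvc.continuousOn
  obtain ⟨W, hW⟩ := (isCompact_Icc (a := -T) (b := T)).exists_bound_of_continuousOn hdv.continuousOn
  have hB0 : 0 ≤ B := (abs_nonneg _).trans (hcB 0)
  set M : ℝ := 2 * (max V 0 * B) + (max W 0 * B + max V 0 * B) with hM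
  have hV0 : 0 ≤ max V 0 := le_max_right _ _
  have hW0 : 0 ≤ max W 0 := le_max_right _ _
  have hM0 : 0 ≤ M := by positivity
  refine ⟨Real.toNNReal M, fun y hy z hz => ?_⟩
  rw [edist_nndist, edist_nndist, ← ENNReal.coe_rpow_of_nonneg _ α.coe_nonneg, ← ENNReal.coe_mul,
    ENNReal.coe_le_coe, ← NNReal.coe_le_coe]
  push_cast
  rw [Real.coe_toNNReal _ hM0, hf y hy, hf z hz, Real.dist_eq]
  have b1 : ∀ y ∈ Icc (-T) T ×ˢ (univ : Set ℝ), |v y.1 * c y.2| ≤ max V 0 * B := fun y hy => by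
    rw [abs_mul]
    exact mul_le_mul ((hV y.1 hy.1).trans (le_max_left _ _)) (hcB _) (abs_nonneg _) hV0
  have hd1 : |y.1 - z.1| ≤ dist y z := by rw [← Real.dist_eq, Prod.dist_eq]; exact le_max_left _ _
  have hd2 : |y.2 - z.2| ≤ dist y z := by rw [← Real.dist_eq, Prod.dist_eq]; exact le_max_right _ _
  rcases le_total (dist y z) 1 with hd | hd
  · have l1 : |v y.1 - v z.1| ≤ max W 0 * |y.1 - z.1| := by
      refine Convex.norm_image_sub_le_of_norm_hasDerivWithin_le (f' := dv) (s := Icc (-T) T)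
        (fun t _ => (hv t).hasDerivWithinAt) (fun t ht => (hW t ht).trans (le_max_left _ _))
        (convex_Icc _ _) hz.1 hy.1
    have l2 : |c y.2 - c z.2| ≤ B * |y.2 - z.2| := by
      refine Convex.norm_image_sub_le_of_norm_hasDerivWithin_le (f' := dc) (s := univ)
        (fun t _ => (hc t).hasDerivWithinAt) (fun t _ => hdcB t) convex_univ trivial trivial
    have e : v y.1 * c y.2 - v z.1 * c z.2 =
        (v y.1 - v z.1) * c y.2 + v z.1 * (c y.2 - c z.2) := by ring
    have hpow : dist y z ≤ dist y z ^ (α : ℝ) := by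
      rcases (dist_nonneg (x := y) (y := z)).eq_or_lt with h0 | h0
      · rw [← h0]; positivity
      · calc dist y z = dist y z ^ (1 : ℝ) := (Real.rpow_one _).symm
          _ ≤ _ := Real.rpow_le_rpow_of_exponent_ge h0 hd (by exact_mod_cast hα)
    calc |v y.1 * c y.2 - v z.1 * c z.2|
        ≤ |(v y.1 - v z.1) * c y.2| + |v z.1 * (c y.2 - c z.2)| := by rw [e]; exact abs_add_le _ _
      _ ≤ (max W 0 * dist y z) * B + max V 0 * (B * dist y z) := by
          rw [abs_mul, abs_mul]
          refine add_le_add (mul_le_mul (l1.trans (by gcongr)) (hcB _) (abs_nonneg _)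
            (by positivity)) (mul_le_mul ((hV z.1 hz.1).trans (le_max_left _ _))
            (l2.trans (by gcongr)) (abs_nonneg _) hV0)
      _ = (max W 0 * B + max V 0 * B) * dist y z := by ring
      _ ≤ M * dist y z := by
          refine mul_le_mul_of_nonneg_right ?_ dist_nonneg
          rw [hM]
          have : 0 ≤ 2 * (max V 0 * B) := by positivity
          linarith
      _ ≤ M * dist y z ^ (α : ℝ) := by gcongr
  · have hpow : 1 ≤ dist y z ^ (α : ℝ) := Real.one_le_rpow hd α.coe_nonneg
    calc |v y.1 * c y.2 - v z.1 * c z.2| ≤ |v y.1 * c y.2| + |v z.1 * c z.2| := abs_sub _ _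
      _ ≤ 2 * (max V 0 * B) := by linarith [b1 y hy, b1 z hz]
      _ ≤ M * 1 := by
          rw [hM]
          have : 0 ≤ max W 0 * B + max V 0 * B := by positivity
          linarith
      _ ≤ M * dist y z ^ (α : ℝ) := by gcongr

end JacobiEquation

/-! ### Modes as elements of the kernel on a bounded piece -/

section Membership

variable {a : ℝ}

theorem HasPartials.partials_eq {I : Set ℝ} (hI : UniqueDiffOn ℝ I)
    {φ φt φθ φtt φtθ φθθ : ℝ → ℝ → ℝ} (h : HasPartials I φ φt φθ φtt φtθ φθθ) {t : ℝ} (ht : t ∈ I)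
    (θ : ℝ) : partialT I (partialT I φ) t θ = φtt t θ ∧
      partialTheta (partialT I φ) t θ = φtθ t θ ∧ partialTheta (partialTheta φ) t θ = φθθ t θ := by
  have h1 : ∀ t ∈ I, ∀ θ, partialT I φ t θ = φt t θ := fun t ht θ =>
    (h.t t ht θ).derivWithin (hI t ht)
  have h2 : ∀ t ∈ I, partialTheta φ t = φθ t := fun t ht => funext fun θ => (h.θ t ht θ).deriv
  refine ⟨?_, ?_, ?_⟩
  · rw [partialT, derivWithin_congr (fun t ht => h1 t ht θ) (h1 t ht θ)]
    exact (h.tt t ht θ).derivWithin (hI t ht)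
  · rw [partialTheta, funext (h1 t ht)]
    exact (h.tθ t ht θ).deriv
  · rw [partialTheta, h2 t ht]
    exact (h.θθ t ht θ).deriv

theorem hasDerivAt_jacobiPotential (ha : a ∈ delaunayParams) (t : ℝ) :
    HasDerivAt (jacobiPotential a) (-4 * (deriv (delaunayX a) t / delaunayX a t) *
      (delaunayGamma a ^ 2 / delaunayX a t ^ 2 - delaunayX a t ^ 2)) t := by
  have hx := (delaunayX_pos ha t).ne'
  have h1 := hasDerivAt_delaunayX ha t
  refine (((h1.pow 2).add ((hasDerivAt_const t (delaunayGamma a ^ 2)).div (h1.pow 2)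
    (pow_ne_zero 2 hx))).const_mul 2).congr_deriv ?_
  simp only [Pi.pow_apply, Nat.cast_ofNat, Nat.add_one_sub_one, pow_one]
  field_simp
  ring

theorem IsMode.memX (ha : a ∈ delaunayParams) {j : ℕ} {w dw : ℝ → ℝ} (h : IsMode a j w dw)
    {α : ℝ≥0} (hα : α ≤ 1) {T : ℝ} (hT : 0 < T) (hT0 : w T = 0) :
    MemX α T fun t θ => w t * Real.cos (j * θ) := by
  have hI : UniqueDiffOn ℝ (Icc (-T) T) := uniqueDiffOn_Icc (by linarith)
  have heq := fun (y : ℝ × ℝ) (hy : y ∈ Icc (-T) T ×ˢ (univ : Set ℝ)) =>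
    (hasPartials_mul_cos h.solves (Icc (-T) T) j).partials_eq hI hy.1 y.2
  have hqc := continuous_modePotential ha j
  have hwc := h.solves.continuous
  have hdwc := h.solves.continuous_deriv
  have hcos : ∀ θ : ℝ, |Real.cos (j * θ)| ≤ 1 := fun θ => Real.abs_cos_le_one _
  have hsin : ∀ θ : ℝ, |Real.sin (j * θ)| ≤ 1 := fun θ => Real.abs_sin_le_one _
  have hj0 : (0 : ℝ) ≤ j := j.cast_nonneg
  have hjs : ∀ θ : ℝ, |-((j : ℝ) * Real.sin (j * θ))| ≤ j := fun θ => by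
    rw [abs_neg, abs_mul, abs_of_nonneg hj0]
    exact mul_le_of_le_one_right hj0 (hsin θ)
  have hjc : ∀ θ : ℝ, |-((j : ℝ) * (j * Real.cos (j * θ)))| ≤ (j : ℝ) * j := fun θ => by
    rw [abs_neg, ← mul_assoc, abs_mul, abs_of_nonneg (by positivity : (0 : ℝ) ≤ j * j)]
    exact mul_le_of_le_one_right (by positivity) (hcos θ)
  have hjs3 : ∀ θ : ℝ, |-((j : ℝ) * (j * -(j * Real.sin (j * θ))))| ≤ (j : ℝ) * (j * j) := fun θ => by
    rw [abs_neg, abs_mul, abs_mul, abs_of_nonneg hj0]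
    exact mul_le_mul_of_nonneg_left (mul_le_mul_of_nonneg_left (hjs θ) hj0) hj0
  have hdcos := fun θ => hasDerivAt_cos_mul j θ
  have hdsin := fun θ => ((hasDerivAt_sin_mul j θ).const_mul (j : ℝ)).neg
  refine ⟨⟨fun t _ θ => ?_, ?_, ?_, ?_, ?_⟩, fun θ => ?_, fun t _ θ => ?_⟩
  · rw [mul_add, Real.cos_add_nat_mul_two_pi]
  · have hw := h.solves.contDiff hqc
    have h1 : ContDiff ℝ 2 fun y : ℝ × ℝ => w y.1 := hw.comp contDiff_fst
    have h2 : ContDiff ℝ 2 fun y : ℝ × ℝ => Real.cos (j * y.2) :=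
      Real.contDiff_cos.comp (contDiff_const.mul contDiff_snd)
    exact (h1.mul h2).contDiffOn
  · refine exists_holderOnWith_mul hα (B := 1 + j)
      (fun t => ((hasDerivAt_jacobiPotential ha t).const_sub ((j : ℝ) ^ 2)).mul
        (h.solves t trivial).1) ?_ hdcos
      (fun θ => (hcos θ).trans (by linarith)) (fun θ => (hjs θ).trans (by linarith))
      (fun y hy => (heq y hy).1)
    have h1 := (solvesOn_logDeriv ha).continuous
    have h2 := (solvesOn_logDeriv ha).continuous_deriv
    exact (((continuous_const.mul h1).mul h2).neg.mul hwc).add (hqc.mul hdwc)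
  · exact exists_holderOnWith_mul hα (B := j + j * j) (fun t => (h.solves t trivial).2)
      (hqc.mul hwc) hdsin (fun θ => (hjs θ).trans (by nlinarith))
      (fun θ => (hjc θ).trans (by linarith)) (fun y hy => (heq y hy).2.1)
  · exact exists_holderOnWith_mul hα (B := j * j + j * (j * j)) (fun t => (h.solves t trivial).1)
      hdwc (fun θ => ((hdcos θ).const_mul (j : ℝ)).const_mul (j : ℝ) |>.neg)
      (fun θ => (hjc θ).trans (by have : (0 : ℝ) ≤ j * (j * j) := by positivity
                                  linarith))
      (fun θ => (hjs3 θ).trans (by nlinarith)) (fun y hy => (heq y hy).2.2)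
  · simp [hT0, h.even ha T]
  · simp [h.even ha t]

theorem modeDegeneracySet_subset (ha : a ∈ delaunayParams) {α : ℝ≥0} (hα : α ≤ 1) (j : ℕ) :
    modeDegeneracySet a j ⊆ degeneracySet α a := by
  obtain ⟨w, dw, h⟩ := exists_isMode ha j
  rw [modeDegeneracySet_eq ha h]
  rintro T ⟨hT, hT0⟩
  refine ⟨hT, _, h.memX ha hα hT hT0, h.jacobiEq ha (uniqueDiffOn_Icc (by linarith)), 0,
    ⟨by linarith, hT.le⟩, 0, ?_⟩
  simp [h.zero]

end Membership

/-! ### Fourier coefficients in the angle -/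

section Fourier

variable {a : ℝ}

/-- A continuous `2π`-periodic function whose real Fourier coefficients all vanish is zero. -/
theorem eq_zero_of_fourier_eq_zero {g : ℝ → ℝ} (hg : Continuous g)
    (hp : Function.Periodic g (2 * Real.pi))
    (hcos : ∀ n : ℕ, ∫ θ in (0 : ℝ)..2 * Real.pi, g θ * Real.cos (n * θ) = 0)
    (hsin : ∀ n : ℕ, ∫ θ in (0 : ℝ)..2 * Real.pi, g θ * Real.sin (n * θ) = 0) : g = 0 := by
  have : Fact (0 < 2 * Real.pi) := ⟨by positivity⟩
  have hpc : Function.Periodic (fun θ => (g θ : ℂ)) (2 * Real.pi) := fun θ => by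
    simp only [hp θ]
  have hgc : Continuous fun θ => (g θ : ℂ) := Complex.continuous_ofReal.comp hg
  let f : C(AddCircle (2 * Real.pi), ℂ) := ⟨hpc.lift, by
    exact continuous_coinduced_dom.2 hgc⟩
  have hf : ∀ θ : ℝ, f (θ : AddCircle (2 * Real.pi)) = g θ := fun θ => rfl
  have hcosz : ∀ n : ℤ, ∫ θ in (0 : ℝ)..2 * Real.pi, g θ * Real.cos (n * θ) = 0 := by
    intro n
    obtain ⟨k, rfl | rfl⟩ := n.eq_nat_or_neg
    · simpa using hcos k
    · simpa using hcos k
  have hsinz : ∀ n : ℤ, ∫ θ in (0 : ℝ)..2 * Real.pi, g θ * Real.sin (n * θ) = 0 := by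
    intro n
    obtain ⟨k, rfl | rfl⟩ := n.eq_nat_or_neg
    · simpa using hsin k
    · simpa using hsin k
  have hcoef : ∀ n, fourierCoeff f n = 0 := by
    intro n
    rw [fourierCoeff_eq_intervalIntegral f n 0, zero_add]
    have e : ∀ θ : ℝ, (fourier (-n) (θ : AddCircle (2 * Real.pi)) : ℂ) • f θ =
        ((g θ * Real.cos (((-n : ℤ) : ℝ) * θ) : ℝ) : ℂ) +
          ((g θ * Real.sin (((-n : ℤ) : ℝ) * θ) : ℝ) : ℂ) * Complex.I := by
      intro θ
      have hpi : (Real.pi : ℂ) ≠ 0 := by exact_mod_cast Real.pi_ne_zero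
      have e1 : 2 * (Real.pi : ℂ) * Complex.I * ((-n : ℤ) : ℂ) * θ / ((2 * Real.pi : ℝ) : ℂ) =
          ((((-n : ℤ) : ℝ) * θ : ℝ) : ℂ) * Complex.I := by
        push_cast
        field_simp
      rw [fourier_coe_apply, hf, e1, Complex.exp_mul_I, ← Complex.ofReal_cos, ← Complex.ofReal_sin]
      push_cast
      rw [smul_eq_mul]
      ring
    simp only [e]
    have i1 : Continuous fun θ : ℝ => ((g θ * Real.cos (((-n : ℤ) : ℝ) * θ) : ℝ) : ℂ) := by fun_prop
    have i2 : Continuous fun θ : ℝ =>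
        ((g θ * Real.sin (((-n : ℤ) : ℝ) * θ) : ℝ) : ℂ) * Complex.I := by fun_prop
    rw [intervalIntegral.integral_add (i1.intervalIntegrable _ _) (i2.intervalIntegrable _ _),
      intervalIntegral.integral_mul_const, intervalIntegral.integral_ofReal,
      intervalIntegral.integral_ofReal, hcosz, hsinz]
    simp
  have hsum : Summable (fourierCoeff f) := by
    rw [show fourierCoeff f = fun _ => 0 from funext hcoef]; exact summable_zero
  funext θ
  have h := has_pointwise_sum_fourier_series_of_summable hsum (θ : AddCircle (2 * Real.pi))
  simp only [hcoef, zero_smul] at h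
  have := h.unique hasSum_zero
  rw [hf] at this
  exact_mod_cast this

/-- Differentiation under the integral sign, for one-sided data on the closed interval and an
interior time. -/
theorem hasDerivAt_integral_mul {T : ℝ} {f ft : ℝ → ℝ → ℝ} {c : ℝ → ℝ} (hc : Continuous c)
    (hf : ContinuousOn (Function.uncurry f) (Icc (-T) T ×ˢ univ))
    (hft : ContinuousOn (Function.uncurry ft) (Icc (-T) T ×ˢ univ))
    (hd : ∀ t ∈ Icc (-T) T, ∀ θ, HasDerivWithinAt (fun s => f s θ) (ft t θ) (Icc (-T) T) t)
    {t : ℝ} (ht : t ∈ Ioo (-T) T) :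
    HasDerivAt (fun t => ∫ θ in (0 : ℝ)..2 * Real.pi, f t θ * c θ)
      (∫ θ in (0 : ℝ)..2 * Real.pi, ft t θ * c θ) t := by
  have hslice : ∀ {h : ℝ → ℝ → ℝ}, ContinuousOn (Function.uncurry h) (Icc (-T) T ×ˢ univ) →
      ∀ t ∈ Icc (-T) T, Continuous fun θ => h t θ * c θ := fun {h} hh t ht =>
    (hh.comp_continuous (by fun_prop : Continuous fun θ : ℝ => (t, θ)) fun θ => ⟨ht, trivial⟩).mul hc
  obtain ⟨C, hC⟩ := (isCompact_Icc.prod isCompact_Icc :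
    IsCompact (Icc (-T) T ×ˢ Icc (0 : ℝ) (2 * Real.pi))).exists_bound_of_continuousOn
    ((hft.mono (prod_mono_right (subset_univ _))).mul (hc.comp continuous_snd).continuousOn)
  have htI := Ioo_subset_Icc_self ht
  refine (intervalIntegral.hasDerivAt_integral_of_dominated_loc_of_deriv_le
    (μ := MeasureTheory.volume) (a := 0) (b := 2 * Real.pi)
    (F := fun t θ => f t θ * c θ) (F' := fun t θ => ft t θ * c θ)
    (s := Ioo (-T) T) (bound := fun _ => C) (Ioo_mem_nhds ht.1 ht.2) ?_
    ((hslice hf t htI).intervalIntegrable _ _) (hslice hft t htI).aestronglyMeasurable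
    (Eventually.of_forall fun θ hθ s hs => ?_) (by simp)
    (Eventually.of_forall fun θ _ s hs => ?_)).2
  · filter_upwards [Ioo_mem_nhds ht.1 ht.2] with s hs
    exact (hslice hf s (Ioo_subset_Icc_self hs)).aestronglyMeasurable
  · rw [uIoc_of_le (by positivity)] at hθ
    exact hC (s, θ) ⟨Ioo_subset_Icc_self hs, Ioc_subset_Icc_self hθ⟩
  · exact ((hd s (Ioo_subset_Icc_self hs) θ).hasDerivAt (Icc_mem_nhds hs.1 hs.2)).mul_const _

/-- The Fourier coefficients of a Jacobi function solve the mode equation in the interior: two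
integrations by parts in `θ`. -/
theorem solvesOn_fourierCoeff (ha : a ∈ delaunayParams) {T : ℝ} (hT : 0 < T) {φ : ℝ → ℝ → ℝ}
    (hφ : ContDiffOn ℝ 2 (Function.uncurry φ) (Icc (-T) T ×ˢ univ))
    (hper : ∀ t ∈ Icc (-T) T, Function.Periodic (φ t) (2 * Real.pi))
    (hJ : JacobiEq (Icc (-T) T) a φ) (n : ℕ) {c dc : ℝ → ℝ} (hc : ∀ θ, HasDerivAt c (dc θ) θ)
    (hdc : ∀ θ, HasDerivAt dc (-((n : ℝ) ^ 2 * c θ)) θ) (hcp : c (2 * Real.pi) = c 0)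
    (hdcp : dc (2 * Real.pi) = dc 0) :
    SolvesOn (fun t => (n : ℝ) ^ 2 - jacobiPotential a t)
      (fun t => ∫ θ in (0 : ℝ)..2 * Real.pi, φ t θ * c θ)
      (fun t => ∫ θ in (0 : ℝ)..2 * Real.pi, partialT (Icc (-T) T) φ t θ * c θ)
      (Ioo (-T) T) := by
  have hI : UniqueDiffOn ℝ (Icc (-T) T) := uniqueDiffOn_Icc (by linarith)
  have hp := hasPartials_of_contDiffOn hI hφ
  rw [jacobiEq_iff ha hI hp] at hJ
  have h11 : (1 : WithTop ℕ∞) + 1 ≤ 2 := by norm_num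
  have h01 : (0 : WithTop ℕ∞) + 1 ≤ 1 := by norm_num
  have hφt := contDiffOn_partialT hI h11 hφ
  have hφθ := contDiffOn_partialTheta hI h11 hφ
  have hφtt := contDiffOn_partialT hI h01 hφt
  have hφθθ := contDiffOn_partialTheta hI h01 hφθ
  have hcc : Continuous c := continuous_iff_continuousAt.2 fun t => (hc t).continuousAt
  intro t ht
  refine ⟨hasDerivAt_integral_mul hcc hφ.continuousOn hφt.continuousOn hp.t ht,
    (hasDerivAt_integral_mul hcc hφt.continuousOn hφtt.continuousOn hp.tt ht).congr_deriv ?_⟩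
  have htI := Ioo_subset_Icc_self ht
  have hslice : ∀ {h : ℝ → ℝ → ℝ}, ContinuousOn (Function.uncurry h) (Icc (-T) T ×ˢ univ) →
      Continuous fun θ => h t θ * c θ := fun {h} hh =>
    (hh.comp_continuous (by fun_prop : Continuous fun θ : ℝ => (t, θ)) fun θ => ⟨htI, trivial⟩).mul hcc
  have i0 := (hslice hφ.continuousOn)
  have i2 := (hslice hφθθ.continuousOn)
  -- the boundary terms cancel by periodicity
  have hparts : ∫ θ in (0 : ℝ)..2 * Real.pi,
      (partialTheta (partialTheta φ) t θ * c θ + (n : ℝ) ^ 2 * (φ t θ * c θ)) = 0 := by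
    have hd : ∀ θ, HasDerivAt (fun θ => partialTheta φ t θ * c θ - φ t θ * dc θ)
        (partialTheta (partialTheta φ) t θ * c θ + (n : ℝ) ^ 2 * (φ t θ * c θ)) θ := fun θ =>
      (((hp.θθ t htI θ).mul (hc θ)).sub ((hp.θ t htI θ).mul (hdc θ))).congr_deriv (by ring)
    rw [intervalIntegral.integral_eq_sub_of_hasDerivAt (fun θ _ => hd θ)
      ((i2.add (continuous_const.mul i0)).intervalIntegrable _ _)]
    have e1 : φ t (2 * Real.pi) = φ t 0 := by simpa using hper t htI 0
    have e2 : partialTheta φ t (2 * Real.pi) = partialTheta φ t 0 := by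
      have h1 := (hp.θ t htI (0 + 2 * Real.pi)).comp_add_const 0 (2 * Real.pi)
      rw [show (fun θ => φ t (θ + 2 * Real.pi)) = φ t from funext (hper t htI), zero_add] at h1
      exact h1.unique (hp.θ t htI 0)
    rw [e1, e2, hcp, hdcp, sub_self]
  have e : ∀ θ, partialT (Icc (-T) T) (partialT (Icc (-T) T) φ) t θ * c θ =
      ((n : ℝ) ^ 2 - jacobiPotential a t) * (φ t θ * c θ) -
        (partialTheta (partialTheta φ) t θ * c θ + (n : ℝ) ^ 2 * (φ t θ * c θ)) := fun θ => by
    linear_combination c θ * hJ t htI θ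
  simp only [e]
  have i3 : Continuous fun θ => ((n : ℝ) ^ 2 - jacobiPotential a t) * (φ t θ * c θ) :=
    continuous_const.mul i0
  have i4 : Continuous fun θ =>
      partialTheta (partialTheta φ) t θ * c θ + (n : ℝ) ^ 2 * (φ t θ * c θ) :=
    i2.add (continuous_const.mul i0)
  rw [intervalIntegral.integral_sub (i3.intervalIntegrable _ _) (i4.intervalIntegrable _ _), hparts,
    intervalIntegral.integral_const_mul, sub_zero]

/-- If `T` is not a zero of the `n`-th mode, the corresponding Fourier coefficients of an element of
the kernel vanish: they are multiples of the `n`-th mode that vanish at `T`. -/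
theorem fourierCoeff_eq_zero (ha : a ∈ delaunayParams) {α : ℝ≥0} {T : ℝ} (hT : 0 < T)
    {φ : ℝ → ℝ → ℝ} (hφ : MemX α T φ) (hJ : JacobiEq (Icc (-T) T) a φ) {n : ℕ} {w dw : ℝ → ℝ}
    (h : IsMode a n w dw) (hwT : w T ≠ 0) {c dc : ℝ → ℝ} (hc : ∀ θ, HasDerivAt c (dc θ) θ)
    (hdc : ∀ θ, HasDerivAt dc (-((n : ℝ) ^ 2 * c θ)) θ) (hcp : c (2 * Real.pi) = c 0)
    (hdcp : dc (2 * Real.pi) = dc 0) {t : ℝ} (ht : t ∈ Ioo (-T) T) :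
    ∫ θ in (0 : ℝ)..2 * Real.pi, φ t θ * c θ = 0 := by
  have hs := solvesOn_fourierCoeff ha hT hφ.isC2Holder.contDiffOn hφ.isC2Holder.periodic hJ n hc hdc
    hcp hdcp
  have hcc : Continuous c := continuous_iff_continuousAt.2 fun t => (hc t).continuousAt
  set W : ℝ → ℝ := fun t => ∫ θ in (0 : ℝ)..2 * Real.pi, φ t θ * c θ with hWdef
  have h0 : (0 : ℝ) ∈ Ioo (-T) T := ⟨by linarith, hT⟩
  have heven : ∀ᶠ t in 𝓝 0, W (-t) = W t := by
    filter_upwards [Ioo_mem_nhds h0.1 h0.2] with t ht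
    simp only [hWdef, ← hφ.even t (Ioo_subset_Icc_self ht)]
  have hdW := deriv_zero_of_eventually_even heven (hs 0 h0).1
  have heq := (SolvesOn.eqOn_Ioo h0 (fun t _ => abs_modePotential_le ha n t) hs
    ((h.solves.const_mul (W 0)).mono (subset_univ _)) (by simp [h.zero])
    (hdW.trans (by rw [h.deriv_zero, mul_zero]))).1
  have hmem : T ∈ Icc (-T) T := ⟨by linarith, le_rfl⟩
  have hWT : W T = 0 := by simp [hWdef, hφ.boundary]
  -- the coefficient is continuous up to the boundary
  have hlim : Tendsto W (𝓝[<] T) (𝓝 (W T)) := by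
    have hcont : ContinuousOn (fun y : ℝ × ℝ => φ y.1 y.2 * c y.2) (Icc (-T) T ×ˢ univ) :=
      hφ.isC2Holder.contDiffOn.continuousOn.mul (hcc.comp continuous_snd).continuousOn
    obtain ⟨C, hC⟩ := (isCompact_Icc.prod isCompact_Icc :
      IsCompact (Icc (-T) T ×ˢ Icc (0 : ℝ) (2 * Real.pi))).exists_bound_of_continuousOn
      (hcont.mono (prod_mono_right (subset_univ _)))
    have hI : ∀ᶠ s in 𝓝[<] T, s ∈ Icc (-T) T := by
      filter_upwards [Ioo_mem_nhdsLT (show -T < T by linarith)] with s hs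
      exact Ioo_subset_Icc_self hs
    refine intervalIntegral.tendsto_integral_filter_of_dominated_convergence (fun _ => C) ?_ ?_
      (by simp) ?_
    · filter_upwards [hI] with s hs
      exact (hcont.comp_continuous (by fun_prop : Continuous fun θ : ℝ => (s, θ))
        fun θ => ⟨hs, trivial⟩).aestronglyMeasurable
    · filter_upwards [hI] with s hs
      refine Eventually.of_forall fun θ hθ => ?_
      rw [uIoc_of_le (by positivity)] at hθ
      exact hC (s, θ) ⟨hs, Ioc_subset_Icc_self hθ⟩
    · refine Eventually.of_forall fun θ _ => ?_
      have h1 : ContinuousWithinAt (fun s => φ s θ * c θ) (Icc (-T) T) T :=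
        (hcont.comp (by fun_prop : Continuous fun s : ℝ => (s, θ)).continuousOn
          (fun s hs => ⟨hs, trivial⟩)) T hmem
      exact h1.mono_left (le_inf nhdsWithin_le_nhds (le_principal_iff.2 hI))
  have hlim2 : Tendsto W (𝓝[<] T) (𝓝 (W 0 * w T)) := by
    have h1 : Tendsto (fun t => W 0 * w t) (𝓝[<] T) (𝓝 (W 0 * w T)) :=
      (continuous_const.mul h.solves.continuous).continuousAt.mono_left nhdsWithin_le_nhds
    refine h1.congr' ?_
    filter_upwards [Ioo_mem_nhdsLT (show -T < T by linarith)] with s hs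
    exact (heq hs).symm
  have hprod := tendsto_nhds_unique hlim hlim2
  rw [hWT] at hprod
  have hW0 : W 0 = 0 := (mul_eq_zero.1 hprod.symm).resolve_right hwT
  have := heq ht
  simp only [hW0, zero_mul] at this
  exact this

theorem sin_nat_mul_two_pi (n : ℕ) : Real.sin (n * (2 * Real.pi)) = 0 := by
  simpa using Real.sin_add_nat_mul_two_pi 0 n

theorem degeneracySet_eq_iUnion (ha : a ∈ delaunayParams) {α : ℝ≥0} (hα : α ≤ 1) :
    degeneracySet α a = ⋃ j : ℕ, modeDegeneracySet a j := by
  refine Subset.antisymm ?_ (iUnion_subset fun j => modeDegeneracySet_subset ha hα j)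
  rintro T ⟨hT, φ, hφ, hJ, t, ht, θ, hne⟩
  by_contra hcon
  simp only [mem_iUnion, not_exists] at hcon
  have htI : t ∈ Ioo (-T) T := by
    refine ⟨lt_of_le_of_ne ht.1 ?_, lt_of_le_of_ne ht.2 ?_⟩
    · rintro rfl; exact hne (hφ.boundary θ).2
    · rintro rfl; exact hne (hφ.boundary θ).1
  have hmode : ∀ n : ℕ, ∃ w dw, IsMode a n w dw ∧ w T ≠ 0 := by
    intro n
    obtain ⟨w, dw, h⟩ := exists_isMode ha n
    have := hcon n
    rw [modeDegeneracySet_eq ha h] at this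
    exact ⟨w, dw, h, fun h0 => this ⟨hT, h0⟩⟩
  have hcont : Continuous (φ t) :=
    hφ.isC2Holder.contDiffOn.continuousOn.comp_continuous
      (by fun_prop : Continuous fun θ : ℝ => (t, θ)) fun θ => ⟨ht, trivial⟩
  have hz := eq_zero_of_fourier_eq_zero hcont (hφ.isC2Holder.periodic t ht)
    (fun n => by
      obtain ⟨w, dw, h, hwT⟩ := hmode n
      exact fourierCoeff_eq_zero ha hT hφ hJ h hwT (hasDerivAt_cos_mul n)
        (fun θ => ((hasDerivAt_sin_mul n θ).const_mul (n : ℝ)).neg.congr_deriv (by ring))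
        (by simp) (by simp [sin_nat_mul_two_pi]) htI)
    (fun n => by
      obtain ⟨w, dw, h, hwT⟩ := hmode n
      exact fourierCoeff_eq_zero ha hT hφ hJ h hwT (hasDerivAt_sin_mul n)
        (fun θ => ((hasDerivAt_cos_mul n θ).const_mul (n : ℝ)).congr_deriv (by ring))
        (by simp [sin_nat_mul_two_pi]) (by simp) htI)
  exact hne (congrFun hz θ)

end Fourier

/-! ### The degeneracy sets -/

theorem theorem1p1 (α : ℝ≥0) (hα₀ : 0 < α) (hα₁ : α < 1) :
    (∀ a ∈ delaunayParams,
      degeneracySet α a = (⋃ j : ℕ, modeDegeneracySet a j) ∧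
      (a ≠ -1 / 2 → ∃ T : ℕ → ℝ,
        (∀ k : ℕ, T k ∈ Ioo (k * delaunayTau a) ((k + 1 / 2) * delaunayTau a)) ∧
        modeDegeneracySet a 0 = range T) ∧
      (a = -1 / 2 → modeDegeneracySet a 0 = range fun k : ℕ => ((k : ℝ) + 1 / 2) * Real.pi) ∧
      (a < 0 → (∀ j : ℕ, 1 ≤ j → modeDegeneracySet a j = ∅) ∧
        degeneracySet α a = modeDegeneracySet a 0) ∧
      (0 < a → modeDegeneracySet a 1 = (range fun k : ℕ => ((k : ℝ) + 1 / 2) * delaunayTau a) ∧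
        modeDegeneracySet a 0 ∩ modeDegeneracySet a 1 = ∅) ∧
      (a ∈ Ioc 0 ((√3 - 1) / 2) → (∀ j : ℕ, 2 ≤ j → modeDegeneracySet a j = ∅) ∧
        degeneracySet α a = modeDegeneracySet a 0 ∪ modeDegeneracySet a 1)) ∧
    ∀ j : ℕ, 2 ≤ j → ∃ aStar : ℝ, 0 < aStar ∧ ∀ a : ℝ, aStar ≤ a →
      (modeDegeneracySet a j).Nonempty := by
  refine ⟨fun a ha => ?_, fun j _ => ⟨(j : ℝ) ^ 2 + 1, by positivity, fun a haj => ?_⟩⟩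
  · have hunion := degeneracySet_eq_iUnion ha hα₁.le
    obtain ⟨w₀, dw₀, h₀⟩ := exists_isMode ha 0
    obtain ⟨w₁, dw₁, h₁⟩ := exists_isMode ha 1
    have hzero : a ≠ -1 / 2 → ∃ T : ℕ → ℝ,
        (∀ k : ℕ, T k ∈ Ioo (k * delaunayTau a) ((k + 1 / 2) * delaunayTau a)) ∧
        modeDegeneracySet a 0 = range T := fun h2 => by
      rw [modeDegeneracySet_eq ha h₀]
      exact zeros_isMode_zero ha h2 h₀
    have hone : 0 < a →
        modeDegeneracySet a 1 = range fun k : ℕ => ((k : ℝ) + 1 / 2) * delaunayTau a := fun h => by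
      rw [modeDegeneracySet_eq ha h₁]
      exact zeros_isMode_one ha h h₁
    have hempty : ∀ j : ℕ, (∀ w dw, IsMode a j w dw → ∀ T, 0 < T → w T ≠ 0) →
        modeDegeneracySet a j = ∅ := fun j hj => by
      obtain ⟨w, dw, h⟩ := exists_isMode ha j
      rw [modeDegeneracySet_eq ha h]
      exact eq_empty_of_forall_notMem fun T hT => hj w dw h T hT.1 hT.2
    refine ⟨hunion, hzero, fun h2 => ?_, fun hneg => ?_, fun hpos => ⟨hone hpos, ?_⟩, fun hmem => ?_⟩
    · rw [modeDegeneracySet_eq ha h₀]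
      exact zeros_isMode_zero_of_eq_neg_half h2 h₀
    · have he : ∀ j : ℕ, 1 ≤ j → modeDegeneracySet a j = ∅ := fun j hj =>
        hempty j fun w dw h T hT => isMode_ne_zero_of_neg ha hneg hj h hT
      refine ⟨he, hunion.trans (Subset.antisymm (iUnion_subset fun j => ?_)
        (subset_iUnion (modeDegeneracySet a) 0))⟩
      rcases Nat.eq_zero_or_pos j with rfl | hj
      · rfl
      · rw [he j hj]; exact empty_subset _
    · have h2 : a ≠ -1 / 2 := by intro h; linarith
      have hτ := (delaunayTau_pos_and_angle ha h2).1
      obtain ⟨T, hT, hTr⟩ := hzero h2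
      rw [hone hpos, hTr]
      refine eq_empty_of_forall_notMem ?_
      rintro _ ⟨⟨k, rfl⟩, l, hl⟩
      -- `(l + 1/2) τ ∈ (k τ, (k + 1/2) τ)` would give `k < l + 1/2` and `l < k`
      obtain ⟨h3, h4⟩ := hT k
      rw [← hl] at h3 h4
      have h5 := lt_of_mul_lt_mul_right h3 hτ.le
      have h6 := lt_of_mul_lt_mul_right h4 hτ.le
      have h7 : (l : ℝ) + 1 ≤ k := by
        have : l < k := by
          have : (l : ℝ) < k := by linarith
          exact_mod_cast this
        exact_mod_cast this
      linarith
    · have he : ∀ j : ℕ, 2 ≤ j → modeDegeneracySet a j = ∅ := fun j hj =>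
        hempty j fun w dw h T hT => isMode_ne_zero_of_le ha hmem.1 hmem.2 hj h hT
      refine ⟨he, hunion.trans (Subset.antisymm (iUnion_subset fun j => ?_)
        (union_subset (subset_iUnion (modeDegeneracySet a) 0)
          (subset_iUnion (modeDegeneracySet a) 1)))⟩
      match j with
      | 0 => exact subset_union_left
      | 1 => exact subset_union_right
      | j + 2 => rw [he (j + 2) (by omega)]; exact empty_subset _
  · have hj : (0 : ℝ) ≤ (j : ℝ) ^ 2 := by positivity
    have hpos : 0 < a := by linarith
    have ha : a ∈ delaunayParams := Or.inr hpos
    obtain ⟨w, dw, h⟩ := exists_isMode ha j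
    rw [modeDegeneracySet_eq ha h]
    obtain ⟨T, hT, hT0⟩ := exists_zero_isMode_of_large ha hpos (by linarith) h (by linarith)
    exact ⟨T, hT, hT0⟩
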